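/- **Setting.** Let $T>0$, $\mu,\sigma\in\mathbb R$, $a<b$. Let $\eta$ be uniform on $[a,b]^d$ and $W$ an independent $d$-dimensional Brownian motion, and let $X_t$ be either (heat) $X_t=\eta+\mu t\mathbf 1_d+\sigma W_t$ or (Black–Scholes) $X_{t,k}=\eta_k\exp((\mu-\sigma^2/2)t+\sigma W_{t,k})$, $1\le k\le d$. Let $0=t_0<\dots<t_N=T$, fix $i\in\{0,\dots,N-1\}$, and put $\Delta t_i=t_{i+1}-t_i$, $\Delta W_{t_i}=W_{t_{i+1}}-W_{t_i}$. Let $f:[0,T]\times\mathbb R^d\times\mathbb R\times\mathbb R^d\to\mathbb R$ and $g:\mathbb R^d\to\mathbb R$ satisfy $$|f(t,x,y,z)-f(t',x',y',z')|\le C_f\big(|t-t'|^{1/2}+\|x-x'\|_2+|y-y'|+\|z-z'\|_2\big),\qquad |g(x)-g(x')|\le C_g\|x-x'\|_2,$$ and put $C_{fg}=\max\{C_f^2,C_g^2,f(0)^2,g(0)^2\}$, where $f(0)=f(0,0,0,0)$. For a function $V$ (the next value function), measurable $U:\mathbb R^d\to\mathbb R$ and $Z:\mathbb R^d\to\mathbb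 R^d$ with $U(X_{t_i}),Z(X_{t_i})$ square integrable, put $$L(U,Z)=\mathbb E\big|V(X_{t_{i+1}})-U(X_{t_i})+f(t_i,X_{t_i},U(X_{t_i}),Z(X_{t_i}))\Delta t_i-Z(X_{t_i})^\top\Delta W_{t_i}\big|^2 ,$$ let $(\mathcal U^*,\mathcal Z^*)$ be a minimizer of $L$ over all such pairs, and $\mathcal L^*=L(\mathcal U^*,\mathcal Z^*)$. A tanh network of structure $\mathcal S=(l_1,\dots,l_{k+1})$ is $A_k\circ\tanh\circ A_{k-1}\circ\dots\circ\tanh\circ A_1$ with affine $A_j:\mathbb R^{l_j}\to\mathbb R^{l_{j+1}}$; its parameter $\theta$ is the list of all weights and biases, $D(\mathcal S)=k$, $\|\mathcal S\|_\infty=\max_j l_j$, and $\mathcal N_{\mathcal S,R}$ is the set of such networks with $\|\theta\|_\infty\le R$. Given $l_2,\dots,l_k$, put $\mathcal S_1=(d,l_2,\dots,l_k,1)$ and $\mathcal S_2=(d,l_2,\dots,l_k,d)$. For $\theta=(\theta_U,\theta_Z)$ with $\|\theta\|_\infty\le R$, let $\mathcal L(\theta)=L(\mathcal U(\cdot;\theta_U),\mathcal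 Z(\cdot;\theta_Z))$ for the networks $\mathcal U(\cdot;\theta_U)\in\mathcal N_{\mathcal S_1,R}$ and $\mathcal Z(\cdot;\theta_Z)\in\mathcal N_{\mathcal S_2,R}$. For $w\in\mathbb R^{3d}$ let $G(w;\theta)$ be the random variable under the expectation in $\mathcal L(\theta)$, evaluated at $$\eta=(b-a)\Phi(w_{1:d})+a,\quad W_{t_i}=\sqrt{t_i}\,w_{d+1:2d},\quad \Delta W_{t_i}=\sqrt{\Delta t_i}\,w_{2d+1:3d},$$ where $\Phi$ is the standard normal distribution function, applied componentwise. Let $\bm w_1,\dots,\bm w_m$ be i.i.d. standard normal in $\mathbb R^{3d}$, and let the random variable $\theta^{(m)}$ be almost surely a minimizer of $\frac1m\sum_{j=1}^mG(\bm w_j;\theta)$ over $\{\|\theta\|_\infty\le R\}$. **Corollary 4.4.** Let $p$ be a polynomial in two variables and $p_0$ a polynomial in three variables. There are polynomials $q$ and $r$, depending only on $T,\mu,\sigma,a,b,p,p_0$, with $r(\delta^{-1},d,C)>0$ for all $\delta>0$, $d\ge1$, $C\ge0$, such that the following holds for both forward processes, all $d\ge1$, all time grids and all $i$, all $f,g$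 as above, and all $\delta,\rho>0$. Suppose that 1. $V=g$ if $i=N-1$; if $i<N-1$, then $V\in\mathcal N_{\mathcal S',R'}$ for some $R'$ and some structure $\mathcal S'$ with input dimension $d$ and output dimension $1$ such that $\max\{R',D(\mathcal S'),\|\mathcal S'\|_\infty\}\le p_0(\delta^{-1},d,C_{fg})$; 2. for every $\varepsilon>0$ there are given hidden widths (hence $\mathcal S_1=\mathcal S_1(\varepsilon)$, $\mathcal S_2=\mathcal S_2(\varepsilon)$) and a bound $R=R(\varepsilon)$ with $\max\{R,D(\mathcal S_1),\|\mathcal S_1\|_\infty\}\le p(d,\varepsilon^{-1})$, such that some $\mathcal U_\varepsilon\in\mathcal N_{\mathcal S_1,R}$ and $\mathcal Z_\varepsilon\in\mathcal N_{\mathcal S_2,R}$ satisfy $$\mathbb E|\mathcal U^*(X_{t_i})-\mathcal U_\varepsilon(X_{t_i})|^2+\mathbb E\|\mathcal Z^*(X_{t_i})-\mathcal Z_\varepsilon(X_{t_i})\|_2^2\le\varepsilon .$$ Take the structures $\mathcal S_1(\varepsilon),\mathcal S_2(\varepsilon)$ and the bound $R(\varepsilon)$ at the accuracy $\varepsilon=1/r(\delta^{-1},d,C_{fg})$.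 Then for every sample size $m\ge q(\delta^{-1},\rho^{-1},d,C_{fg})$, $$\mathbb P\big(\mathcal L(\theta^{(m)})-\mathcal L^*\le\delta\big)\ge1-\rho .$$ -/

import Mathlib

open MeasureTheory ProbabilityTheory
open scoped NNReal

noncomputable section

namespace DBDP

/-- The state space `ℝ^d` with its Euclidean norm. -/
abbrev State (d : ℕ) : Type := EuclideanSpace ℝ (Fin d)

/-! ### Feedforward tanh networks -/

/-- Index set of the weights and biases of a network with input dimension `n`, list of hidden
widths `hs` and output dimension `o`.  The network has `hs.length + 1` affine layers; a layer
`ℝ^n → ℝ^h` has the weights `Fin h × Fin n` and the biases `Fin h`. -/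
def ParamIdx : ℕ → List ℕ → ℕ → Type
  | n, [], o => (Fin o × Fin n) ⊕ Fin o
  | n, h :: hs, o => ((Fin h × Fin n) ⊕ Fin h) ⊕ ParamIdx h hs o

instance instFintypeParamIdx : (n : ℕ) → (hs : List ℕ) → (o : ℕ) → Fintype (ParamIdx n hs o)
  | n, [], o => inferInstanceAs (Fintype ((Fin o × Fin n) ⊕ Fin o))
  | n, h :: hs, o =>
    letI : Fintype (ParamIdx h hs o) := instFintypeParamIdx h hs o
    inferInstanceAs (Fintype (((Fin h × Fin n) ⊕ Fin h) ⊕ ParamIdx h hs o))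

/-- The map `A_k ∘ tanh ∘ A_{k-1} ∘ ⋯ ∘ tanh ∘ A_1` with parameters `θ`
(`tanh` acts componentwise, and not after the last affine map). -/
def netEval : (n : ℕ) → (hs : List ℕ) → (o : ℕ) → (ParamIdx n hs o → ℝ) → (Fin n → ℝ) → Fin o → ℝ
  | _, [], _, θ, x => fun j => ∑ c, θ (Sum.inl (j, c)) * x c + θ (Sum.inr j)
  | _, h :: hs, o, θ, x =>
    netEval h hs o (fun l => θ (Sum.inr l))
      (fun j => Real.tanh
        (∑ c, θ (Sum.inl (Sum.inl (j, c))) * x c + θ (Sum.inl (Sum.inr j))))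

/-- Depth (number of affine layers) of a network with hidden widths `hs`. -/
def netDepth (hs : List ℕ) : ℕ := hs.length + 1

/-- Width of a network: the maximum of all layer dimensions, input and output included. -/
def netWidth (n : ℕ) (hs : List ℕ) (o : ℕ) : ℕ := max n (hs.foldr max o)

/-- The scalar network `𝒰(·; θ) : ℝ^d → ℝ`. -/
def netU {d : ℕ} {hs : List ℕ} (θ : ParamIdx d hs 1 → ℝ) (x : State d) : ℝ :=
  netEval d hs 1 θ (fun k => x k) 0

/-- The vector-valued network `𝒵(·; θ) : ℝ^d → ℝ^d`. -/
def netZ {d : ℕ} {hs : List ℕ} (θ : ParamIdx d hs d → ℝ) (x : State d) : State d :=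
  WithLp.toLp 2 (netEval d hs d θ (fun k => x k))

/-- Joint parameter `θ = (θ_U, θ_Z)` of a pair of networks with structures `(d, hs, 1)` and
`(d, hs, d)`; its norm is the sup norm over all weights and biases. -/
abbrev NetParams (d : ℕ) (hs : List ℕ) : Type := (ParamIdx d hs 1 → ℝ) × (ParamIdx d hs d → ℝ)

/-- `max {R, D(𝒮), ‖𝒮‖_∞} ≤ s` for the structure `𝒮 = (d, hs, 1)` and the parameter bound `R`. -/
def SizeLE (d : ℕ) (hs : List ℕ) (R s : ℝ) : Prop :=
  max R (max (netDepth hs : ℝ) (netWidth d hs 1 : ℝ)) ≤ s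

/-! ### The forward process -/

/-- The two forward equations: arithmetic Brownian motion `dX = μ 1 dt + σ dW` (heat) and
geometric Brownian motion `dX = μ X dt + σ diag(X) dW` (Black-Scholes). -/
inductive ForwardModel
  | heat
  | blackScholes

/-- Exact solution of the forward equation at time `h` after starting in `x`, when the Brownian
motion has moved by `Δ`. -/
def forwardStep {d : ℕ} (M : ForwardModel) (μ σ : ℝ) (x : Fin d → ℝ) (h : ℝ) (Δ : Fin d → ℝ) :
    State d :=
  match M with
  | .heat => WithLp.toLp 2 fun k => x k + μ * h + σ * Δ k
  | .blackScholes => WithLp.toLp 2 fun k => x k * Real.exp ((μ - σ ^ 2 / 2) * h + σ * Δ k)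

/-- `B` is a standard `d`-dimensional Brownian motion and `η` is an independent random variable
that is uniformly distributed on `[a, b]^d`. -/
structure IsDrivingNoise {d : ℕ} {Ω : Type*} [MeasurableSpace Ω] (a b : ℝ)
    (η : Ω → Fin d → ℝ) (B : ℝ≥0 → Ω → Fin d → ℝ) (P : Measure Ω) : Prop where
  uniform : pdf.IsUniform η (Set.Icc (fun _ => a) (fun _ => b)) P volume
  brownian : ∀ k, IsBrownianReal (fun t ω => B t ω k) P
  indep_coord : iIndepFun (fun (k : Fin d) (ω : Ω) (t : ℝ≥0) => B t ω k) P
  indep_init : IndepFun η (fun ω t => B t ω) P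

/-- The forward process `X_t`, started in `η`. -/
def forwardProcess {d : ℕ} {Ω : Type*} (M : ForwardModel) (μ σ : ℝ)
    (η : Ω → Fin d → ℝ) (B : ℝ≥0 → Ω → Fin d → ℝ) (t : ℝ≥0) (ω : Ω) : State d :=
  forwardStep M μ σ (η ω) t (B t ω)

/-! ### The equation and the loss -/

/-- `f` is Lipschitz in `(x, y, z)` and `1/2`-Hölder in `t ∈ [0, T]` with constant `Cf`, and `g` is
Lipschitz with constant `Cg`. -/
structure LipschitzCoefficients {d : ℕ} (T Cf Cg : ℝ) (f : ℝ → State d → ℝ → State d → ℝ)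
    (g : State d → ℝ) : Prop where
  Cf_nonneg : 0 ≤ Cf
  Cg_nonneg : 0 ≤ Cg
  driver : ∀ t₁ ∈ Set.Icc 0 T, ∀ t₂ ∈ Set.Icc 0 T, ∀ x₁ x₂ y₁ y₂ z₁ z₂,
    |f t₁ x₁ y₁ z₁ - f t₂ x₂ y₂ z₂| ≤
      Cf * (Real.sqrt |t₁ - t₂| + ‖x₁ - x₂‖ + |y₁ - y₂| + ‖z₁ - z₂‖)
  terminal : ∀ x₁ x₂, |g x₁ - g x₂| ≤ Cg * ‖x₁ - x₂‖

/-- `C_{fg} = max {C_f², C_g², f(0)², g(0)²}`. -/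
def coefConst {d : ℕ} (Cf Cg : ℝ) (f : ℝ → State d → ℝ → State d → ℝ) (g : State d → ℝ) : ℝ :=
  max (max (Cf ^ 2) (Cg ^ 2)) (max (f 0 0 0 0 ^ 2) (g 0 ^ 2))

/-- `0 = t_0 < t_1 < ⋯ < t_N = T`. -/
structure IsTimeGrid {N : ℕ} (T : ℝ) (t : Fin (N + 1) → ℝ≥0) : Prop where
  start : t 0 = 0
  strictMono : StrictMono t
  final : (t (Fin.last N) : ℝ) = T

/-- `F(t, x, y, z, h, Δ) = y - f(t, x, y, z) h + zᵀ Δ`. -/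
def stepF {d : ℕ} (f : ℝ → State d → ℝ → State d → ℝ) (t : ℝ) (x : State d) (y : ℝ) (z : State d)
    (h : ℝ) (Δ : Fin d → ℝ) : ℝ :=
  y - f t x y z * h + ∑ k, z k * Δ k

/-- The loss of the pair `(U, Z)` on the time step from `t` to `s`, with next value function `V`:
`E |V(X_s) - F(t, X_t, U(X_t), Z(X_t), s - t, B_s - B_t)|²`. -/
def loss {d : ℕ} {Ω : Type*} [MeasurableSpace Ω] (M : ForwardModel) (μ σ : ℝ)
    (η : Ω → Fin d → ℝ) (B : ℝ≥0 → Ω → Fin d → ℝ) (P : Measure Ω)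
    (f : ℝ → State d → ℝ → State d → ℝ) (t s : ℝ≥0) (V : State d → ℝ)
    (U : State d → ℝ) (Z : State d → State d) : ℝ :=
  ∫ ω, (V (forwardProcess M μ σ η B s ω)
    - stepF f t (forwardProcess M μ σ η B t ω) (U (forwardProcess M μ σ η B t ω))
        (Z (forwardProcess M μ σ η B t ω)) ((s : ℝ) - t) (B s ω - B t ω)) ^ 2 ∂P

/-- `U` and `Z` are measurable, and `U(X)` and `Z(X)` are square integrable. -/
def Admissible {d : ℕ} {Ω : Type*} [MeasurableSpace Ω] (P : Measure Ω) (X : Ω → State d)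
    (U : State d → ℝ) (Z : State d → State d) : Prop :=
  Measurable U ∧ Measurable Z ∧ MemLp (fun ω => U (X ω)) 2 P ∧ MemLp (fun ω => Z (X ω)) 2 P

/-- `(U, Z)` minimizes the loss over all admissible pairs of functions. -/
def IsOptimalPair {d : ℕ} {Ω : Type*} [MeasurableSpace Ω] (M : ForwardModel) (μ σ : ℝ)
    (η : Ω → Fin d → ℝ) (B : ℝ≥0 → Ω → Fin d → ℝ) (P : Measure Ω)
    (f : ℝ → State d → ℝ → State d → ℝ) (t s : ℝ≥0) (V : State d → ℝ)
    (U : State d → ℝ) (Z : State d → State d) : Prop :=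
  Admissible P (forwardProcess M μ σ η B t) U Z ∧
    ∀ U' Z', Admissible P (forwardProcess M μ σ η B t) U' Z' →
      loss M μ σ η B P f t s V U Z ≤ loss M μ σ η B P f t s V U' Z'

/-- The next value function `V` of time step `i`: the terminal function `g` on the last step, and
before it a scalar network, with parameters bounded by some `R`, of size at most `S`. -/
def IsNextValue {d N : ℕ} (i : Fin N) (g : State d → ℝ) (S : ℝ) (V : State d → ℝ) : Prop :=
  ((i : ℕ) + 1 = N ∧ V = g) ∨
    ((i : ℕ) + 1 < N ∧ ∃ (hs : List ℕ) (R : ℝ) (θ : ParamIdx d hs 1 → ℝ),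
      ‖θ‖ ≤ R ∧ SizeLE d hs R S ∧ V = netU θ)

/-- The networks with hidden widths `hs` and parameter bound `R` approximate `(U, Z)` up to mean
square error `ε` along `X`, and have size at most `p(d, ε⁻¹)`. -/
def ApproximatesAt {d : ℕ} {Ω : Type*} [MeasurableSpace Ω] (P : Measure Ω) (X : Ω → State d)
    (U : State d → ℝ) (Z : State d → State d) (p : MvPolynomial (Fin 2) ℝ) (ε : ℝ)
    (hs : List ℕ) (R : ℝ) : Prop :=
  SizeLE d hs R (MvPolynomial.eval ![(d : ℝ), ε⁻¹] p) ∧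
    ∃ θ : NetParams d hs, ‖θ‖ ≤ R ∧
      ∫ ω, (U (X ω) - netU θ.1 (X ω)) ^ 2 ∂P + ∫ ω, ‖Z (X ω) - netZ θ.2 (X ω)‖ ^ 2 ∂P ≤ ε

/-! ### The empirical risk -/

/-- The standard normal law on `ℝ^{3d}`. -/
def stdNormal (d : ℕ) : Measure (Fin 3 × Fin d → ℝ) :=
  Measure.pi fun _ => gaussianReal 0 1

/-- The loss at one sample `w ∈ ℝ^{3d}`, where the initial value, the Brownian motion at time `t`
and its increment are simulated by `η = (b - a) Φ(w_{1:d}) + a`, `W_t = √t w_{d+1:2d}` and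
`ΔW = √(s - t) w_{2d+1:3d}`, with `Φ` the standard normal distribution function. -/
def sampleLoss {d : ℕ} (M : ForwardModel) (μ σ a b : ℝ) (f : ℝ → State d → ℝ → State d → ℝ)
    (t s : ℝ≥0) (V : State d → ℝ) (U : State d → ℝ) (Z : State d → State d)
    (w : Fin 3 × Fin d → ℝ) : ℝ :=
  let η : Fin d → ℝ := fun k => (b - a) * cdf (gaussianReal 0 1) (w (0, k)) + a
  let Wt : Fin d → ℝ := fun k => Real.sqrt t * w (1, k)
  let ΔW : Fin d → ℝ := fun k => Real.sqrt ((s : ℝ) - t) * w (2, k)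
  let x : State d := forwardStep M μ σ η t Wt
  let x' : State d := forwardStep M μ σ (fun k => x k) ((s : ℝ) - t) ΔW
  (V x' - stepF f t x (U x) (Z x) ((s : ℝ) - t) ΔW) ^ 2

/-- The empirical risk `(1/m) ∑ G(w_j; θ)`. -/
def empiricalRisk {d m : ℕ} {hs : List ℕ} (M : ForwardModel) (μ σ a b : ℝ)
    (f : ℝ → State d → ℝ → State d → ℝ) (t s : ℝ≥0) (V : State d → ℝ)
    (w : Fin m → Fin 3 × Fin d → ℝ) (θ : NetParams d hs) : ℝ :=
  (1 / (m : ℝ)) * ∑ j, sampleLoss M μ σ a b f t s V (netU θ.1) (netZ θ.2) (w j)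

/-- `θ` minimizes the empirical risk over `{θ | ‖θ‖_∞ ≤ R}`. -/
def IsEmpiricalMinimizer {d m : ℕ} {hs : List ℕ} (M : ForwardModel) (μ σ a b : ℝ)
    (f : ℝ → State d → ℝ → State d → ℝ) (t s : ℝ≥0) (V : State d → ℝ)
    (w : Fin m → Fin 3 × Fin d → ℝ) (R : ℝ) (θ : NetParams d hs) : Prop :=
  ‖θ‖ ≤ R ∧ ∀ θ' : NetParams d hs, ‖θ'‖ ≤ R →
    empiricalRisk M μ σ a b f t s V w θ ≤ empiricalRisk M μ σ a b f t s V w θ'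

end DBDP

end

noncomputable section

namespace DBDP

/-! ### Empirical risk minimization over a class with a finite cover -/

section EmpiricalRisk

/-! All constants of one time step are bounded by a power `Y` of S = 2 + δ⁻¹ + d + C_fg. It
therefore suffices to take ε as a negative power of `Y` and m as a power of a larger such bound
times 1 + ρ⁻¹. As S ≥ 2, numerical constants are absorbed by raising exponents, which is why the
exponents are generous.

The driving noise (η, W_t, W_s - W_t) has the law of the noise simulated from a standard normal
vector (`IsDrivingNoise.hasLaw`), so every loss is an integral of a squared residual over the
standard normal law. With θ₀ the parameter of the approximating networks, the excess risk is the sum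
of a statistical error L(θ^(m)) - L(θ₀) and an approximation error L(θ₀) - L*. Each is made at most
δ/2.

Approximation error (`StepBound.integral_sq_residual_le_add`). The residual is Lipschitz in (U, Z),
except that the difference of the Z is multiplied by the Brownian increment. The increment is
independent of X_t, so second moments multiply, and L² closeness of the pairs gives L² closeness of
the residuals. A weighted Young inequality passes to the squares, because L* is at most the loss of
(0, 0), which is polynomial in `Y`.

Statistical error (`empirical_minimizer_risk_le`). The squared residual is unbounded, with an
envelope built from exponentials of Gaussians, so Hoeffding's inequality does not apply to it
directly. But uniformity over the class is needed only for the statement that the true risk is not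
much larger than the empirical one. In that direction the loss may be truncated to {E ≤ K}: this
lowers the empirical risk and costs the true risk at most A / K², by a fourth moment of the
envelope. The truncated loss is bounded, so Hoeffding and a union bound over a finite cover apply.
The opposite direction is needed only for the fixed θ₀, where Chebyshev suffices.

The Lipschitz constant of a network in its parameters is exponential in the depth. Only its
logarithm enters the logarithm of the cover size, which stays polynomial in `Y` (`cover_card_le`),
so polynomially many samples are enough. -/

lemma abs_indicator_sq_sub_le {W : Type*} {H H' E : W → ℝ} {κ K : ℝ} (hκ : 0 ≤ κ)
    (hHE : ∀ w, |H w| ≤ E w) (hHE' : ∀ w, |H' w| ≤ E w)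
    (h : ∀ w, |H w - H' w| ≤ κ * E w) (w : W) :
    |{w | E w ≤ K}.indicator (fun w => H w ^ 2) w - {w | E w ≤ K}.indicator (fun w => H' w ^ 2) w|
      ≤ 2 * κ * K ^ 2 := by
  by_cases hw : E w ≤ K
  · simp only [Set.indicator, Set.mem_ofPred_eq, hw, if_true]
    have hE0 : 0 ≤ E w := (abs_nonneg _).trans (hHE w)
    have h2 : |H w + H' w| ≤ 2 * E w := (abs_add_le _ _).trans (by linarith [hHE w, hHE' w])
    calc |H w ^ 2 - H' w ^ 2| = |H w - H' w| * |H w + H' w| := by rw [← abs_mul]; congr 1; ring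
      _ ≤ (κ * E w) * (2 * E w) := by gcongr; exact h w
      _ = 2 * κ * E w ^ 2 := by ring
      _ ≤ 2 * κ * K ^ 2 := by gcongr
  · simp only [Set.indicator, Set.mem_ofPred_eq, hw, if_false, sub_zero, abs_zero]
    positivity

variable {W : Type*} [MeasurableSpace W] {ν : Measure W}

variable {Ω : Type*} [MeasurableSpace Ω] {P : Measure Ω}

section

variable [IsProbabilityMeasure P]

/-- Chebyshev's inequality for the upper deviation of an empirical mean. -/
lemma chebyshev_empirical_mean {m : ℕ} (hm : 0 < m) {w : Fin m → Ω → W} (hw : iIndepFun w P)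
    (hlaw : ∀ j, HasLaw (w j) ν P) {G : W → ℝ} (hG : Measurable G) {A : ℝ}
    (hGi : Integrable (fun x => G x ^ 2) ν) (hA : ∫ x, G x ^ 2 ∂ν ≤ A) {δ : ℝ} (hδ : 0 < δ) :
    P.real {ω | ∫ x, G x ∂ν + δ ≤ (1 / (m : ℝ)) * ∑ j, G (w j ω)} ≤ A / (m * δ ^ 2) := by
  have hm' : (0 : ℝ) < m := by exact_mod_cast hm
  have hL : ∀ j, MemLp (fun ω => G (w j ω)) 2 P := fun j => by
    refine (memLp_two_iff_integrable_sq
      (hG.comp_aemeasurable (hlaw j).aemeasurable).aestronglyMeasurable).2 ?_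
    rw [← (hlaw j).map_eq] at hGi
    exact (integrable_map_measure hGi.aestronglyMeasurable (hlaw j).aemeasurable).1 hGi
  have hint : ∀ j, ∫ ω, G (w j ω) ∂P = ∫ x, G x ∂ν := fun j => by
    rw [← (hlaw j).map_eq, integral_map (hlaw j).aemeasurable hG.aestronglyMeasurable]
  have hvar : ∀ j, Var[fun ω => G (w j ω); P] ≤ A := fun j => by
    refine (variance_le_expectation_sq (hL j).aestronglyMeasurable).trans (le_trans (le_of_eq ?_) hA)
    rw [← (hlaw j).map_eq]
    rw [integral_map (hlaw j).aemeasurable (hG.pow_const 2).aestronglyMeasurable]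
    rfl
  have hvs : Var[∑ j, fun ω => G (w j ω); P] ≤ m * A := by
    rw [IndepFun.variance_sum (fun j _ => hL j)]
    · calc ∑ j : Fin m, Var[fun ω => G (w j ω); P] ≤ ∑ _j : Fin m, A :=
            Finset.sum_le_sum fun j _ => hvar j
        _ = m * A := by simp
    · intro i _ j _ hij
      exact (hw.indepFun hij).comp hG hG
  have hLs : MemLp (∑ j, fun ω => G (w j ω)) 2 P := memLp_finsetSum' _ fun j _ => hL j
  have hch := meas_ge_le_variance_div_sq hLs (c := m * δ) (by positivity)
  have hEs : P[∑ j, fun ω => G (w j ω)] = m * ∫ x, G x ∂ν := by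
    simp only [Finset.sum_apply]
    rw [integral_finsetSum _ fun j _ => (hL j).integrable (by norm_num)]
    simp [hint]
  rw [hEs] at hch
  have h1 : P.real {ω | ∫ x, G x ∂ν + δ ≤ (1 / (m : ℝ)) * ∑ j, G (w j ω)} ≤
      Var[∑ j, fun ω => G (w j ω); P] / (m * δ) ^ 2 := by
    refine ENNReal.toReal_le_of_le_ofReal (div_nonneg (variance_nonneg _ _) (sq_nonneg _))
      ((measure_mono fun ω hω => ?_).trans hch)
    simp only [Set.mem_ofPred_eq, Finset.sum_apply] at hω ⊢
    refine le_trans ?_ (le_abs_self _)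
    have := mul_le_mul_of_nonneg_left hω hm'.le
    have h3 : (m : ℝ) * (1 / (m : ℝ) * ∑ j, G (w j ω)) = ∑ j, G (w j ω) := by field_simp
    rw [h3] at this
    linarith
  refine h1.trans ?_
  calc Var[∑ j, fun ω => G (w j ω); P] / (m * δ) ^ 2 ≤ m * A / (m * δ) ^ 2 := by gcongr
    _ = A / (m * δ ^ 2) := by field_simp

end

variable [IsProbabilityMeasure ν]

/-- H² ≤ E² ≤ 1 + E⁴, and constants are integrable for a probability measure. -/
lemma integrable_sq_of_abs_le {H E : W → ℝ} (hH : AEStronglyMeasurable H ν)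
    (hHE : ∀ w, |H w| ≤ E w) (hE : Integrable (fun w => E w ^ 4) ν) :
    Integrable (fun w => H w ^ 2) ν := by
  refine ((integrable_const (1 : ℝ)).add hE).mono' (hH.pow 2) (.of_forall fun w => ?_)
  have h1 : H w ^ 2 ≤ E w ^ 2 := sq_le_sq' (abs_le.1 (hHE w)).1 (abs_le.1 (hHE w)).2
  simp only [Real.norm_eq_abs, abs_of_nonneg (sq_nonneg (H w)), Pi.add_apply]
  nlinarith [sq_nonneg (E w ^ 2 - 1)]

/-- The risk exceeds the risk truncated to `{E ≤ K}` by at most `A / K²`. -/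
lemma integral_sq_le_integral_indicator_add {H E : W → ℝ} {A K : ℝ} (hH : Measurable H)
    (hE : Measurable E) (hHE : ∀ w, |H w| ≤ E w) (hEi : Integrable (fun w => E w ^ 4) ν)
    (hA : ∫ w, E w ^ 4 ∂ν ≤ A) (hK : 0 < K) :
    ∫ w, H w ^ 2 ∂ν ≤ ∫ w, {w | E w ≤ K}.indicator (fun w => H w ^ 2) w ∂ν + A / K ^ 2 := by
  have hi := integrable_sq_of_abs_le hH.aestronglyMeasurable hHE hEi
  have hs : MeasurableSet {w | E w ≤ K} := measurableSet_le hE measurable_const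
  calc ∫ w, H w ^ 2 ∂ν
      ≤ ∫ w, ({w | E w ≤ K}.indicator (fun w => H w ^ 2) w + E w ^ 4 / K ^ 2) ∂ν := by
        refine integral_mono hi ((hi.indicator hs).add (hEi.div_const _)) fun w => ?_
        have hE0 : 0 ≤ E w := (abs_nonneg _).trans (hHE w)
        have h1 : H w ^ 2 ≤ E w ^ 2 := sq_le_sq' (abs_le.1 (hHE w)).1 (abs_le.1 (hHE w)).2
        by_cases h : E w ≤ K
        · simp only [Set.indicator, Set.mem_ofPred_eq, h, if_true]
          have : 0 ≤ E w ^ 4 / K ^ 2 := by positivity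
          linarith
        · simp only [Set.indicator, Set.mem_ofPred_eq, h, if_false, zero_add]
          -- Where E exceeds K, a factor E² / K² ≥ 1 may be inserted: H² ≤ E² ≤ E⁴ / K².
          rw [le_div_iff₀ (by positivity)]
          have : K ^ 2 ≤ E w ^ 2 := by gcongr; exact (not_le.1 h).le
          calc H w ^ 2 * K ^ 2 ≤ E w ^ 2 * E w ^ 2 := by gcongr
            _ = E w ^ 4 := by ring
    _ = ∫ w, {w | E w ≤ K}.indicator (fun w => H w ^ 2) w ∂ν + (∫ w, E w ^ 4 ∂ν) / K ^ 2 := by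
        rw [integral_add (hi.indicator hs) (hEi.div_const _), integral_div]
    _ ≤ _ := by gcongr

variable [IsProbabilityMeasure P]

/-- Hoeffding's inequality for the lower deviation of an empirical mean. -/
lemma hoeffding_empirical_mean {m : ℕ} (hm : 0 < m) {w : Fin m → Ω → W} (hw : iIndepFun w P)
    (hlaw : ∀ j, HasLaw (w j) ν P) {G : W → ℝ} (hG : Measurable G) {D : ℝ}
    (hG0 : ∀ x, 0 ≤ G x) (hGD : ∀ x, G x ≤ D) {δ : ℝ} (hδ : 0 ≤ δ) :
    P.real {ω | (1 / (m : ℝ)) * ∑ j, G (w j ω) + δ ≤ ∫ x, G x ∂ν}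
      ≤ Real.exp (-(2 * m * δ ^ 2 / D ^ 2)) := by
  have hD : 0 ≤ D := by
    obtain ⟨x⟩ : Nonempty W := ν.nonempty_of_neZero
    exact (hG0 x).trans (hGD x)
  have hsub : ∀ j, HasSubgaussianMGF (fun ω => (∫ x, G x ∂ν) - G (w j ω))
      ((‖(0 : ℝ) - (-D)‖₊ / 2) ^ 2) P := fun j => by
    have h := hasSubgaussianMGF_of_mem_Icc (μ := P) (X := fun ω => -G (w j ω)) (a := -D) (b := 0)
      (hG.comp_aemeasurable (hlaw j).aemeasurable).neg
      (.of_forall fun ω => ⟨neg_le_neg (hGD _), neg_nonpos.2 (hG0 _)⟩)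
    have hi : P[fun ω => -G (w j ω)] = -∫ x, G x ∂ν := by
      rw [integral_neg, ← (hlaw j).map_eq, integral_map (hlaw j).aemeasurable
        hG.aestronglyMeasurable]
    rw [hi] at h
    refine h.congr (.of_forall fun ω => ?_)
    simp only; ring
  have hind : iIndepFun (fun j ω => (∫ x, G x ∂ν) - G (w j ω)) P :=
    hw.comp (fun _ x => (∫ x, G x ∂ν) - G x) fun _ => measurable_const.sub hG
  have hmain := HasSubgaussianMGF.measure_sum_ge_le_of_iIndepFun hind
    (s := Finset.univ) (fun j _ => hsub j) (ε := m * δ) (by positivity)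
  have hm' : (0 : ℝ) < m := by exact_mod_cast hm
  refine le_trans (le_of_eq ?_) (hmain.trans (le_of_eq ?_))
  · congr 1
    ext ω
    simp only [Set.mem_ofPred_eq, Finset.sum_sub_distrib, Finset.sum_const, Finset.card_univ,
      Fintype.card_fin, nsmul_eq_mul]
    rw [← mul_le_mul_iff_right₀ hm']
    have : (m : ℝ) * (1 / (m : ℝ) * ∑ j, G (w j ω) + δ) = ∑ j, G (w j ω) + m * δ := by
      field_simp
    rw [this]
    constructor <;> intro h <;> linarith
  · congr 1
    simp only [zero_sub, neg_neg, Finset.sum_const, Finset.card_univ, Fintype.card_fin,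
      nsmul_eq_mul, NNReal.coe_mul, NNReal.coe_natCast, NNReal.coe_pow, NNReal.coe_div, coe_nnnorm,
      NNReal.coe_ofNat, Real.norm_eq_abs, abs_of_nonneg hD]
    -- For D = 0 both exponents are quotients by 0, hence 0.
    by_cases hD0 : D = 0
    · simp [hD0]
    field_simp

/-- A minimizer of the empirical risk over a class of functions with an envelope `E`, and with a
finite cover on the scale of `E`, has with large probability a risk close to that of any
competitor. -/
theorem empirical_minimizer_risk_le {Θ J : Type*} [Fintype J] {𝓑 : Set Θ} {H : Θ → W → ℝ}
    {E : W → ℝ} (hH : ∀ θ, Measurable (H θ)) (hE : Measurable E)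
    (hHE : ∀ θ ∈ 𝓑, ∀ x, |H θ x| ≤ E x) {A : ℝ} (hEi : Integrable (fun x => E x ^ 4) ν)
    (hA : ∫ x, E x ^ 4 ∂ν ≤ A) {c : J → Θ} (hc : ∀ j, c j ∈ 𝓑) {κ : ℝ} (hκ : 0 ≤ κ)
    (hcov : ∀ θ ∈ 𝓑, ∃ j, ∀ x, |H θ x - H (c j) x| ≤ κ * E x)
    {m : ℕ} (hm : 0 < m) {w : Fin m → Ω → W} (hw : iIndepFun w P)
    (hlaw : ∀ j, HasLaw (w j) ν P) {θh : Ω → Θ} {θ₀ : Θ} (hθ₀ : θ₀ ∈ 𝓑)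
    (hθ : ∀ᵐ ω ∂P, θh ω ∈ 𝓑 ∧ (1 / (m : ℝ)) * ∑ j, H (θh ω) (w j ω) ^ 2 ≤
      (1 / (m : ℝ)) * ∑ j, H θ₀ (w j ω) ^ 2) {δ K : ℝ} (hδ : 0 < δ) (hK : 0 < K) :
    1 - (Fintype.card J * Real.exp (-(2 * m * δ ^ 2 / K ^ 4)) + A / (m * δ ^ 2)) ≤
      P.real {ω | ∫ x, H (θh ω) x ^ 2 ∂ν ≤
        ∫ x, H θ₀ x ^ 2 ∂ν + (2 * δ + 4 * κ * K ^ 2 + A / K ^ 2)} := by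
  set GK : Θ → W → ℝ := fun θ => {x | E x ≤ K}.indicator (fun x => H θ x ^ 2) with hGK
  have hs : MeasurableSet {x | E x ≤ K} := measurableSet_le hE measurable_const
  have hGm : ∀ θ, Measurable (GK θ) := fun θ => ((hH θ).pow_const 2).indicator hs
  have hG0 : ∀ θ x, 0 ≤ GK θ x := fun θ x => Set.indicator_nonneg (fun _ _ => sq_nonneg _) x
  have hGle : ∀ θ x, GK θ x ≤ H θ x ^ 2 := fun θ x =>
    Set.indicator_le_self' (fun _ _ => sq_nonneg _) x
  have hGD : ∀ θ ∈ 𝓑, ∀ x, GK θ x ≤ K ^ 2 := fun θ h x => by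
    by_cases hx : E x ≤ K
    · simp only [hGK, Set.indicator, Set.mem_ofPred_eq, hx, if_true]
      exact (sq_abs (H θ x)).symm.trans_le
        (pow_le_pow_left₀ (abs_nonneg _) ((hHE θ h x).trans hx) 2)
    · simp only [hGK, Set.indicator, Set.mem_ofPred_eq, hx, if_false]
      positivity
  have hGi : ∀ θ ∈ 𝓑, Integrable (GK θ) ν := fun θ h =>
    (integrable_sq_of_abs_le (hH θ).aestronglyMeasurable (hHE θ h) hEi).indicator hs
  have hpow : ∀ x, (H θ₀ x ^ 2) ^ 2 ≤ E x ^ 4 := fun x => by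
    rw [← sq_abs (H θ₀ x), ← pow_mul]
    exact pow_le_pow_left₀ (abs_nonneg _) (hHE θ₀ hθ₀ x) 4
  have hH4i : Integrable (fun x => (H θ₀ x ^ 2) ^ 2) ν := by
    refine hEi.mono' (((hH θ₀).pow_const 2).pow_const 2).aestronglyMeasurable
      (.of_forall fun x => ?_)
    rw [Real.norm_eq_abs, abs_of_nonneg (by positivity)]
    exact hpow x
  have hH4 : ∫ x, (H θ₀ x ^ 2) ^ 2 ∂ν ≤ A := by
    exact (integral_mono hH4i hEi hpow).trans hA
  set bad : J → Set Ω := fun j =>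
    {ω | (1 / (m : ℝ)) * ∑ i, GK (c j) (w i ω) + δ ≤ ∫ x, GK (c j) x ∂ν} with hbad
  set bad₀ : Set Ω :=
    {ω | ∫ x, H θ₀ x ^ 2 ∂ν + δ ≤ (1 / (m : ℝ)) * ∑ j, H θ₀ (w j ω) ^ 2} with hbad₀
  set good : Set Ω := {ω | ∫ x, H (θh ω) x ^ 2 ∂ν ≤
        ∫ x, H θ₀ x ^ 2 ∂ν + (2 * δ + 4 * κ * K ^ 2 + A / K ^ 2)} with hgood
  have hb : ∀ j, P.real (bad j) ≤ Real.exp (-(2 * m * δ ^ 2 / K ^ 4)) := fun j => by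
    have := hoeffding_empirical_mean hm hw hlaw (hGm (c j)) (hG0 _) (hGD _ (hc j)) hδ.le
    rwa [← pow_mul] at this
  have hb₀ : P.real bad₀ ≤ A / (m * δ ^ 2) :=
    chebyshev_empirical_mean hm hw hlaw ((hH θ₀).pow_const 2) hH4i hH4 hδ
  have hcover : ∀ᵐ ω ∂P, ω ∈ good ∪ ((⋃ j, bad j) ∪ bad₀) := by
    filter_upwards [hθ] with ω ⟨hω, hmin⟩
    by_contra hcon
    simp only [Set.mem_union, Set.mem_iUnion, not_or, not_exists] at hcon
    obtain ⟨hg, hbj, hb0⟩ := hcon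
    apply hg
    obtain ⟨j, hj⟩ := hcov _ hω
    have hd := abs_indicator_sq_sub_le (K := K) hκ (hHE _ hω) (hHE _ (hc j)) hj
    have hd' : ∀ x, |GK (θh ω) x - GK (c j) x| ≤ 2 * κ * K ^ 2 := hd
    have s1 := integral_sq_le_integral_indicator_add (hH (θh ω)) hE (hHE _ hω) hEi hA hK
    have s2 : ∫ x, GK (θh ω) x ∂ν ≤ ∫ x, GK (c j) x ∂ν + 2 * κ * K ^ 2 := by
      calc ∫ x, GK (θh ω) x ∂ν ≤ ∫ x, (GK (c j) x + 2 * κ * K ^ 2) ∂ν :=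
            integral_mono (hGi _ hω) ((hGi _ (hc j)).add (integrable_const _)) fun x => by
              have := (abs_le.1 (hd' x)).2
              simp only
              linarith
        _ = _ := by rw [integral_add (hGi _ (hc j)) (integrable_const _)]; simp
    have s3 : ∫ x, GK (c j) x ∂ν ≤ (1 / (m : ℝ)) * ∑ i, GK (c j) (w i ω) + δ := by
      have := hbj j
      simp only [hbad, Set.mem_ofPred_eq, not_le] at this
      exact this.le
    have hm' : (0 : ℝ) < m := by exact_mod_cast hm
    have s4 : (1 / (m : ℝ)) * ∑ i, GK (c j) (w i ω) ≤
        (1 / (m : ℝ)) * ∑ i, H (θh ω) (w i ω) ^ 2 + 2 * κ * K ^ 2 := by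
      calc (1 / (m : ℝ)) * ∑ i, GK (c j) (w i ω)
          ≤ (1 / (m : ℝ)) * ∑ i, (H (θh ω) (w i ω) ^ 2 + 2 * κ * K ^ 2) := by
            gcongr with i
            have := (abs_le.1 (hd' (w i ω))).1
            have := hGle (θh ω) (w i ω)
            linarith
        _ = _ := by
            rw [Finset.sum_add_distrib]
            simp only [Finset.sum_const, Finset.card_univ, Fintype.card_fin, nsmul_eq_mul]
            field_simp
    have s5 : (1 / (m : ℝ)) * ∑ j, H θ₀ (w j ω) ^ 2 ≤ ∫ x, H θ₀ x ^ 2 ∂ν + δ := by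
      simp only [hbad₀, Set.mem_ofPred_eq, not_le] at hb0
      exact hb0.le
    simp only [hgood, Set.mem_ofPred_eq]
    linarith
  -- The set `good` need not be measurable. Only monotonicity and subadditivity are used, and these
  -- hold for the outer measure.
  have h1 : (1 : ℝ) ≤ P.real (good ∪ ((⋃ j, bad j) ∪ bad₀)) := by
    rw [← probReal_univ (μ := P)]
    exact ENNReal.toReal_mono (measure_ne_top _ _)
      (measure_mono_ae (hcover.mono fun ω hω _ => hω))
  have h2 : P.real (good ∪ ((⋃ j, bad j) ∪ bad₀)) ≤ P.real good + (∑ j, P.real (bad j) +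
      P.real bad₀) :=
    (measureReal_union_le _ _).trans (add_le_add_right ((measureReal_union_le _ _).trans
      (add_le_add_left (measureReal_iUnion_fintype_le _) _)) _)
  have h3 : ∑ j, P.real (bad j) ≤ Fintype.card J * Real.exp (-(2 * m * δ ^ 2 / K ^ 4)) := by
    calc ∑ j, P.real (bad j) ≤ ∑ _j : J, Real.exp (-(2 * m * δ ^ 2 / K ^ 4)) :=
          Finset.sum_le_sum fun j _ => hb j
      _ = _ := by simp
  linarith

end EmpiricalRisk

/-! ### Bounds for tanh networks -/

/-- Since 1 ≤ X, the bias counts as one more summand of size R X; hence the factor w + 1. -/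
lemma abs_affine_le {n : ℕ} {v x : Fin n → ℝ} {b w R X : ℝ} (hn : (n : ℝ) ≤ w) (hX : 1 ≤ X)
    (hv : ∀ c, |v c| ≤ R) (hb : |b| ≤ R) (hx : ∀ c, |x c| ≤ X) :
    |∑ c, v c * x c + b| ≤ R * (w + 1) * X := by
  have hR : 0 ≤ R := (abs_nonneg _).trans hb
  have h1 : |∑ c, v c * x c| ≤ n * (R * X) := by
    refine (Finset.abs_sum_le_sum_abs _ _).trans ?_
    calc ∑ c, |v c * x c| ≤ ∑ _c : Fin n, R * X := by
          refine Finset.sum_le_sum fun c _ => ?_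
          rw [abs_mul]
          exact mul_le_mul (hv c) (hx c) (abs_nonneg _) hR
      _ = n * (R * X) := by simp
  calc |∑ c, v c * x c + b| ≤ n * (R * X) + R :=
        (abs_add_le _ _).trans (add_le_add h1 hb)
    _ ≤ w * (R * X) + R * X := by
        gcongr
        nlinarith
    _ = R * (w + 1) * X := by ring

/-- Splits v x - v' x' = v (x - x') + (v - v') x'. An input error C X κ leaves the layer in the same
form, with C multiplied by (w + 1)(R + 1). The free constant C is what makes the induction over the
layers go through. -/
lemma abs_affine_sub_le {n : ℕ} {v v' x x' : Fin n → ℝ} {b b' w R X C κ : ℝ} (hn : (n : ℝ) ≤ w)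
    (hX : 1 ≤ X) (hC : 1 ≤ C) (hR : 0 ≤ R) (hv : ∀ c, |v c| ≤ R)
    (hvv : ∀ c, |v c - v' c| ≤ κ) (hbb : |b - b'| ≤ κ) (hx : ∀ c, |x' c| ≤ X)
    (hxx : ∀ c, |x c - x' c| ≤ C * X * κ) :
    |(∑ c, v c * x c + b) - (∑ c, v' c * x' c + b')| ≤ ((w + 1) * (R + 1)) * C * X * κ := by
  have hκ : 0 ≤ κ := (abs_nonneg _).trans hbb
  have hw : 0 ≤ w := (Nat.cast_nonneg n).trans hn
  have h1 : |∑ c, (v c * x c - v' c * x' c)| ≤ n * (R * (C * X * κ) + κ * X) := by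
    refine (Finset.abs_sum_le_sum_abs _ _).trans ?_
    calc ∑ c, |v c * x c - v' c * x' c| ≤ ∑ _c : Fin n, (R * (C * X * κ) + κ * X) := by
          refine Finset.sum_le_sum fun c _ => ?_
          have : v c * x c - v' c * x' c = v c * (x c - x' c) + (v c - v' c) * x' c := by ring
          rw [this]
          refine (abs_add_le _ _).trans ?_
          rw [abs_mul, abs_mul]
          exact add_le_add (mul_le_mul (hv c) (hxx c) (abs_nonneg _) hR)
            (mul_le_mul (hvv c) (hx c) (abs_nonneg _) hκ)
      _ = _ := by
        rw [Finset.sum_const, Finset.card_univ, Fintype.card_fin, nsmul_eq_mul]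
  have h2 : κ * X ≤ C * X * κ := by
    have : 0 ≤ X * κ := by positivity
    nlinarith
  have h3 : κ ≤ κ * X := by nlinarith
  have h4 : 0 ≤ C * X * κ := by positivity
  calc |(∑ c, v c * x c + b) - (∑ c, v' c * x' c + b')|
      = |∑ c, (v c * x c - v' c * x' c) + (b - b')| := by
        rw [Finset.sum_sub_distrib]; congr 1; ring
    _ ≤ n * (R * (C * X * κ) + κ * X) + κ := (abs_add_le _ _).trans (add_le_add h1 hbb)
    _ ≤ w * (R * (C * X * κ) + C * X * κ) + C * X * κ := by
        gcongr
        exact h3.trans h2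
    _ ≤ ((w + 1) * (R + 1)) * C * X * κ := by
        have := mul_nonneg hR h4
        nlinarith

lemma abs_tanh_le_one (x : ℝ) : |Real.tanh x| ≤ 1 := (Real.abs_tanh_lt_one x).le

/-- The derivative 1 / cosh² is at most 1. -/
lemma abs_tanh_sub_le (x y : ℝ) : |Real.tanh x - Real.tanh y| ≤ |x - y| := by
  have hd : ∀ z ∈ Set.univ, HasDerivWithinAt Real.tanh (1 / Real.cosh z ^ 2) Set.univ z := by
    intro z _
    have h := (Real.hasDerivAt_sinh z).div (Real.hasDerivAt_cosh z) (Real.cosh_pos z).ne'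
    rw [← sq, ← sq, Real.cosh_sq_sub_sinh_sq] at h
    refine (h.congr_of_eventuallyEq (.of_forall fun y => ?_)).hasDerivWithinAt
    exact Real.tanh_eq_sinh_div_cosh y
  have hb : ∀ z ∈ Set.univ, ‖1 / Real.cosh z ^ 2‖ ≤ 1 := fun z _ => by
    have := Real.one_le_cosh z
    rw [Real.norm_eq_abs, abs_of_nonneg (by positivity)]
    exact div_le_one_of_le₀ (one_le_pow₀ this) (by positivity)
  simpa using convex_univ.norm_image_sub_le_of_norm_hasDerivWithin_le hd hb
    (Set.mem_univ y) (Set.mem_univ x)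

lemma continuous_tanh : Continuous Real.tanh :=
  (LipschitzWith.of_dist_le_mul (K := 1) fun x y => by
    simpa [Real.dist_eq] using abs_tanh_sub_le x y).continuous

lemma netWidth_tail_le (n h : ℕ) (hs : List ℕ) (o : ℕ) :
    netWidth h hs o ≤ netWidth n (h :: hs) o := by
  simp [netWidth]

lemma le_netWidth (n : ℕ) (hs : List ℕ) (o : ℕ) : n ≤ netWidth n hs o := le_max_left _ _

/-- A network grows at most linearly in its input, with a constant that does not depend on the
depth. -/
lemma abs_netEval_le (hs : List ℕ) : ∀ {n o : ℕ} {θ : ParamIdx n hs o → ℝ} {x : Fin n → ℝ}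
    {w R X : ℝ}, (netWidth n hs o : ℝ) ≤ w → 1 ≤ X → (∀ l, |θ l| ≤ R) → (∀ c, |x c| ≤ X) →
    ∀ j, |netEval n hs o θ x j| ≤ R * (w + 1) * X := by
  induction hs with
  | nil =>
    intro n o θ x w R X hw hX hθ hx j
    exact abs_affine_le (le_trans (by exact_mod_cast le_netWidth n [] o) hw) hX
      (fun c => hθ (Sum.inl (j, c))) (hθ (Sum.inr j)) hx
  | cons h hs ih =>
    intro n o θ x w R X hw hX hθ hx j
    -- The hidden activations are at most 1 ≤ X, so the tail network sees inputs bounded by the same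
    -- X and the earlier layers leave no trace in the bound.
    exact ih (le_trans (by exact_mod_cast netWidth_tail_le n h hs o) hw) hX
      (fun l => hθ (Sum.inr l)) (fun c => (abs_tanh_le_one _).trans hX) j

/-- Networks are Lipschitz in their parameters on bounded sets of parameters. -/
lemma abs_netEval_sub_le (hs : List ℕ) : ∀ {n o : ℕ} {θ θ' : ParamIdx n hs o → ℝ}
    {x x' : Fin n → ℝ} {w R X C κ : ℝ}, (netWidth n hs o : ℝ) ≤ w → 1 ≤ X → 1 ≤ C → 0 ≤ R →
    (∀ l, |θ l| ≤ R) → (∀ l, |θ l - θ' l| ≤ κ) → (∀ c, |x' c| ≤ X) →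
    (∀ c, |x c - x' c| ≤ C * X * κ) →
    ∀ j, |netEval n hs o θ x j - netEval n hs o θ' x' j| ≤
      ((w + 1) * (R + 1)) ^ netDepth hs * C * X * κ := by
  induction hs with
  | nil =>
    intro n o θ θ' x x' w R X C κ hw hX hC hR hθ hθθ hx hxx j
    rw [netDepth, List.length_nil, zero_add, pow_one]
    exact abs_affine_sub_le (le_trans (by exact_mod_cast le_netWidth n [] o) hw) hX hC hR
      (fun c => hθ (Sum.inl (j, c))) (fun c => hθθ (Sum.inl (j, c))) (hθθ (Sum.inr j)) hx hxx
  | cons h hs ih =>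
    intro n o θ θ' x x' w R X C κ hw hX hC hR hθ hθθ hx hxx j
    have hw0 : 0 ≤ w := le_trans (Nat.cast_nonneg _) hw
    have hM : 1 ≤ ((w + 1) * (R + 1)) * C := by
      have : 1 ≤ (w + 1) * (R + 1) := by nlinarith
      nlinarith
    -- The first layer is absorbed into the constant C of the tail network, while X stays the same
    -- because tanh is bounded by 1.
    refine (ih (C := ((w + 1) * (R + 1)) * C) (X := X) (κ := κ) (w := w)
      (le_trans (by exact_mod_cast netWidth_tail_le n h hs o) hw) hX hM hR
      (fun l => hθ (Sum.inr l)) (fun l => hθθ (Sum.inr l))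
      (fun c => (abs_tanh_le_one _).trans hX) (fun c => (abs_tanh_sub_le _ _).trans ?_) j).trans
      (le_of_eq ?_)
    · exact abs_affine_sub_le (le_trans (by exact_mod_cast le_netWidth n (h :: hs) o) hw) hX hC hR
        (fun k => hθ (Sum.inl (Sum.inl (c, k)))) (fun k => hθθ (Sum.inl (Sum.inl (c, k))))
        (hθθ (Sum.inl (Sum.inr c))) hx hxx
    · rw [netDepth, netDepth, List.length_cons, pow_succ _ (hs.length + 1)]
      ring

lemma continuous_netEval (hs : List ℕ) : ∀ {n o : ℕ} (θ : ParamIdx n hs o → ℝ),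
    Continuous (netEval n hs o θ) := by
  induction hs with
  | nil =>
    intro n o θ
    refine continuous_pi fun j => ?_
    simp only [netEval]
    fun_prop
  | cons h hs ih =>
    intro n o θ
    simp only [netEval]
    refine (ih _).comp (continuous_pi fun j => continuous_tanh.comp ?_)
    fun_prop

lemma continuous_netU {d : ℕ} {hs : List ℕ} (θ : ParamIdx d hs 1 → ℝ) :
    Continuous (netU θ) :=
  (continuous_apply 0).comp ((continuous_netEval hs θ).comp (by fun_prop))

lemma continuous_netZ {d : ℕ} {hs : List ℕ} (θ : ParamIdx d hs d → ℝ) :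
    Continuous (netZ θ) :=
  (PiLp.continuous_toLp 2 _).comp ((continuous_netEval hs θ).comp (by fun_prop))

/-- An affine layer between dimensions at most w has at most w² weights and w biases. -/
lemma card_paramIdx_le (hs : List ℕ) : ∀ {n o w : ℕ}, netWidth n hs o ≤ w →
    Fintype.card (ParamIdx n hs o) ≤ netDepth hs * (w * w + w) := by
  induction hs with
  | nil =>
    intro n o w hw
    have h1 : n ≤ w := (le_netWidth n [] o).trans hw
    have h2 : o ≤ w := (le_max_right n o).trans hw
    have : Fintype.card (ParamIdx n [] o) = o * n + o := by
      change Fintype.card ((Fin o × Fin n) ⊕ Fin o) = _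
      simp
    rw [this, netDepth, List.length_nil, zero_add, one_mul]
    gcongr
  | cons h hs ih =>
    intro n o w hw
    have h1 : n ≤ w := (le_netWidth n _ o).trans hw
    have h2 : netWidth h hs o ≤ w := (netWidth_tail_le n h hs o).trans hw
    have h3 : h ≤ w := (le_netWidth h hs o).trans h2
    have : Fintype.card (ParamIdx n (h :: hs) o) = h * n + h + Fintype.card (ParamIdx h hs o) := by
      change Fintype.card (((Fin h × Fin n) ⊕ Fin h) ⊕ ParamIdx h hs o) = _
      simp
    rw [this]
    have h4 := ih h2
    have h5 : h * n + h ≤ w * w + w := by gcongr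
    calc h * n + h + Fintype.card (ParamIdx h hs o)
        ≤ (w * w + w) + netDepth hs * (w * w + w) := add_le_add h5 h4
      _ = netDepth (h :: hs) * (w * w + w) := by simp only [netDepth, List.length_cons]; ring

/-- The grid point nearest to `x` from below. -/
lemma exists_grid_point {R κ : ℝ} (hκ : 0 < κ) {x : ℝ} (hx : |x| ≤ R) :
    ∃ k : Fin (⌊2 * R / κ⌋₊ + 1), |x - (-R + κ * (k : ℕ))| ≤ κ := by
  have h := abs_le.1 hx
  have h0 : 0 ≤ (x + R) / κ := div_nonneg (by linarith) hκ.le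
  refine ⟨⟨⌊(x + R) / κ⌋₊, Nat.lt_succ_of_le (Nat.floor_le_floor ?_)⟩, ?_⟩
  · gcongr
    linarith
  · have h1 := Nat.floor_le h0
    have h2 := Nat.lt_floor_add_one ((x + R) / κ)
    rw [le_div_iff₀ hκ] at h1
    rw [div_lt_iff₀ hκ] at h2
    rw [abs_le]
    constructor <;> simp only <;> nlinarith

lemma abs_grid_point_le {R κ : ℝ} (hR : 0 ≤ R) (hκ : 0 < κ) (k : Fin (⌊2 * R / κ⌋₊ + 1)) :
    |-R + κ * ((k : ℕ) : ℝ)| ≤ R := by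
  have h1 : ((k : ℕ) : ℝ) ≤ 2 * R / κ :=
    (Nat.cast_le.2 (Nat.le_of_lt_succ k.2)).trans (Nat.floor_le (by positivity))
  rw [le_div_iff₀ hκ] at h1
  have : (0 : ℝ) ≤ ((k : ℕ) : ℝ) := Nat.cast_nonneg _
  rw [abs_le]
  constructor <;> nlinarith

/-- A sup norm ball of parameters has a cover whose logarithmic size is the number of parameters
times the logarithm of the resolution. -/
lemma exists_finite_cover_pi {ι : Type*} [Fintype ι] {R κ : ℝ} (hR : 0 ≤ R) (hκ : 0 < κ) :
    ∃ (c : (ι → Fin (⌊2 * R / κ⌋₊ + 1)) → ι → ℝ), (∀ j, ‖c j‖ ≤ R) ∧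
      ∀ θ : ι → ℝ, ‖θ‖ ≤ R → ∃ j, ‖θ - c j‖ ≤ κ := by
  refine ⟨fun j l => -R + κ * ((j l : ℕ) : ℝ), fun j => ?_, fun θ hθ => ?_⟩
  · exact (pi_norm_le_iff_of_nonneg hR).2 fun l => abs_grid_point_le hR hκ _
  · choose j hj using fun l => exists_grid_point hκ ((norm_le_pi_norm θ l).trans hθ)
    exact ⟨j, (pi_norm_le_iff_of_nonneg hκ.le).2 hj⟩

/-! ### The simulated noise has the law of the driving noise -/

/-- The jump of the distribution function at x is the mass of {x}, which is zero; right continuity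
holds for every distribution function. -/
lemma continuous_cdf (μ : Measure ℝ) [IsProbabilityMeasure μ] [NullSingletonClass μ] :
    Continuous (cdf μ) := by
  refine continuous_iff_continuousAt.2 fun x => ?_
  have h := (cdf μ).measure_singleton x
  rw [measure_cdf, measure_singleton] at h
  have h1 : cdf μ x ≤ Function.leftLim (cdf μ) x := by
    have := ENNReal.ofReal_eq_zero.1 h.symm
    linarith
  rw [Monotone.continuousAt_iff_leftLim_eq_rightLim (monotone_cdf μ), (cdf μ).rightLim_eq]
  exact le_antisymm ((monotone_cdf μ).leftLim_le le_rfl) h1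

/-- Probability integral transform. -/
lemma measure_cdf_le (μ : Measure ℝ) [IsProbabilityMeasure μ] [NullSingletonClass μ] (u : ℝ) :
    μ {x | cdf μ x ≤ u} = ENNReal.ofReal (min 1 u) := by
  have hivt : ∀ v ∈ Set.Ioo (0 : ℝ) 1, ∃ x, cdf μ x = v := fun v hv =>
    mem_range_of_exists_le_of_exists_ge (continuous_cdf μ)
      ((tendsto_cdf_atBot μ).eventually_le_const hv.1).exists
      ((tendsto_cdf_atTop μ).eventually_const_le hv.2).exists
  rcases lt_or_ge u 0 with h0 | h0
  · have : {x | cdf μ x ≤ u} = ∅ := by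
      ext x
      simpa using h0.trans_le (cdf_nonneg μ x)
    rw [this, measure_empty, ENNReal.ofReal_of_nonpos ((min_le_right _ _).trans h0.le)]
  rcases le_or_gt 1 u with h1 | h1
  · have : {x | cdf μ x ≤ u} = Set.univ := by
      ext x
      simpa using (cdf_le_one μ x).trans h1
    rw [this, measure_univ, min_eq_left h1, ENNReal.ofReal_one]
  rw [min_eq_right h1.le]
  refine le_antisymm ?_ ?_
  -- If the mass exceeded u, some r < 1 would lie strictly between. It is a value `cdf μ x`, and the
  -- sublevel set at u is contained in the half-line up to x, of mass r.
  · by_contra! hlt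
    obtain ⟨r, hr1, hr2⟩ := ENNReal.lt_iff_exists_nnreal_btwn.1 hlt
    have hur : u < r := by
      rwa [← ENNReal.ofReal_coe_nnreal, ENNReal.ofReal_lt_ofReal_iff_of_nonneg h0] at hr1
    have hr3 : (r : ℝ) < 1 := by
      have := hr2.trans_le prob_le_one
      exact_mod_cast this
    obtain ⟨x, hx⟩ := hivt r ⟨h0.trans_lt hur, hr3⟩
    refine hr2.not_ge ?_
    rw [← ENNReal.ofReal_coe_nnreal, ← hx, ofReal_cdf]
    refine measure_mono fun y hy => ?_
    by_contra hxy
    have := monotone_cdf μ (not_le.1 hxy).le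
    rw [Set.mem_ofPred_eq] at hy
    linarith
  -- The level 0 is separate, since the distribution function need not attain it.
  · rcases h0.eq_or_lt with rfl | h0
    · simp
    obtain ⟨x, hx⟩ := hivt u ⟨h0, h1⟩
    rw [← hx, ofReal_cdf]
    exact measure_mono fun y hy => monotone_cdf μ hy

/-- Laws on the line are determined by half-lines, where the probability integral transform gives
the uniform distribution function. -/
lemma map_cdf_eq_cond (μ : Measure ℝ) [IsProbabilityMeasure μ] [NullSingletonClass μ] {a b : ℝ}
    (hab : a < b) :
    μ.map (fun x => (b - a) * cdf μ x + a) = ProbabilityTheory.cond volume (Set.Icc a b) := by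
  have hba : 0 < b - a := sub_pos.2 hab
  have hm : Measurable fun x => (b - a) * cdf μ x + a :=
    ((monotone_cdf μ).measurable.const_mul _).add_const _
  have : IsProbabilityMeasure (μ.map (fun x => (b - a) * cdf μ x + a)) :=
    Measure.isProbabilityMeasure_map hm.aemeasurable
  refine Measure.ext_of_Iic _ _ fun v => ?_
  rw [Measure.map_apply hm measurableSet_Iic, ProbabilityTheory.cond_apply measurableSet_Icc]
  have h1 : (fun x => (b - a) * cdf μ x + a) ⁻¹' Set.Iic v = {x | cdf μ x ≤ (v - a) / (b - a)} := by
    ext x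
    simp only [Set.mem_preimage, Set.mem_Iic, Set.mem_ofPred_eq, le_div_iff₀ hba]
    constructor <;> intro h <;> linarith
  have h2 : Set.Icc a b ∩ Set.Iic v = Set.Icc a (min b v) := by
    ext x
    simp only [Set.mem_inter_iff, Set.mem_Icc, Set.mem_Iic, le_min_iff]
    tauto
  rw [h1, measure_cdf_le, h2, Real.volume_Icc, Real.volume_Icc, mul_comm, ← div_eq_mul_inv,
    ← ENNReal.ofReal_div_of_pos hba]
  congr 1
  rw [← min_sub_sub_right, ← min_div_div_right hba.le, div_self hba.ne']

/-- The uniform law on the cube is a product because both the volume of the cube and its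
intersection with a box factor over the coordinates. -/
lemma cond_Icc_pi (d : ℕ) {a b : ℝ} (hab : a < b) :
    ProbabilityTheory.cond volume (Set.Icc (fun _ : Fin d => a) (fun _ => b)) =
      Measure.pi fun _ => ProbabilityTheory.cond volume (Set.Icc a b) := by
  have : IsProbabilityMeasure (ProbabilityTheory.cond (volume : Measure ℝ) (Set.Icc a b)) :=
    ProbabilityTheory.cond_isProbabilityMeasure_of_finite
      (by simp [Real.volume_Icc, hab]) (by simp [Real.volume_Icc])
  refine (Measure.pi_eq fun A hA => ?_).symm
  rw [ProbabilityTheory.cond_apply measurableSet_Icc, ← Set.pi_univ_Icc, ← Set.pi_inter_distrib,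
    volume_pi_pi, volume_pi_pi]
  simp_rw [ProbabilityTheory.cond_apply (measurableSet_Icc (a := a) (b := b))]
  rw [Finset.prod_mul_distrib]
  congr 1
  simp [ENNReal.inv_pow]

/-- The noise `(η, W_t, W_s - W_t)` as a vector in `ℝ^{3d}`. -/
def drivingNoise {d : ℕ} {Ω : Type*} (η : Ω → Fin d → ℝ) (B : ℝ≥0 → Ω → Fin d → ℝ) (t s : ℝ≥0)
    (ω : Ω) (l : Fin 3 × Fin d) : ℝ :=
  (![η ω l.2, B t ω l.2, B s ω l.2 - B t ω l.2] : Fin 3 → ℝ) l.1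

/-- The coordinate maps that simulate the noise `(η, W_t, W_s - W_t)` from standard normals. -/
def simulate (a b : ℝ) (t s : ℝ≥0) : Fin 3 → ℝ → ℝ :=
  ![fun x => (b - a) * cdf (gaussianReal 0 1) x + a, fun x => Real.sqrt t * x,
    fun x => Real.sqrt ((s : ℝ) - t) * x]

lemma measurable_simulate (a b : ℝ) (t s : ℝ≥0) (j : Fin 3) :
    Measurable (simulate a b t s j) := by
  fin_cases j
  · exact ((monotone_cdf _).measurable.const_mul _).add_const _
  · exact measurable_const_mul _
  · exact measurable_const_mul _

lemma map_sqrt_mul_gaussianReal (v : ℝ≥0) :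
    (gaussianReal 0 1).map (fun x => Real.sqrt v * x) = gaussianReal 0 v := by
  rw [gaussianReal_map_const_mul]
  congr 1
  · simp
  · ext
    simp

instance isProbabilityMeasure_stdNormal (d : ℕ) : IsProbabilityMeasure (stdNormal d) := by
  unfold stdNormal
  infer_instance

lemma IsDrivingNoise.aemeasurable_init {d : ℕ} {Ω : Type*} [MeasurableSpace Ω] {P : Measure Ω}
    {a b : ℝ} (hab : a < b)
    {η : Ω → Fin d → ℝ} {B : ℝ≥0 → Ω → Fin d → ℝ} (h : IsDrivingNoise a b η B P) :
    AEMeasurable η P := by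
  refine h.uniform.aemeasurable ?_ ?_ <;> rw [← Set.pi_univ_Icc, volume_pi_pi] <;>
    simp [Real.volume_Icc, hab]

/-- The law of the driving noise is the law of the simulated noise. -/
lemma IsDrivingNoise.hasLaw {d : ℕ} {Ω : Type*} [MeasurableSpace Ω] {P : Measure Ω}
    [IsProbabilityMeasure P] {a b : ℝ} (hab : a < b)
    {η : Ω → Fin d → ℝ} {B : ℝ≥0 → Ω → Fin d → ℝ} (h : IsDrivingNoise a b η B P)
    {t s : ℝ≥0} (hts : t ≤ s) :
    HasLaw (drivingNoise η B t s)
      ((stdNormal d).map fun w l => simulate a b t s l.1 (w l)) P := by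
  have hη : AEMeasurable η P := h.aemeasurable_init hab
  have hB : ∀ r k, AEMeasurable (fun ω => B r ω k) P := fun r k => (h.brownian k).aemeasurable r
  have hN : AEMeasurable (drivingNoise η B t s) P := by
    refine aemeasurable_pi_lambda _ fun ⟨j, k⟩ => ?_
    fin_cases j
    · exact (measurable_pi_apply k).comp_aemeasurable hη
    · exact hB t k
    · exact (hB s k).sub (hB t k)
  refine ⟨hN, ?_⟩
  have hlaw : ∀ j, IsProbabilityMeasure ((gaussianReal 0 1).map (simulate a b t s j)) := fun j =>
    Measure.isProbabilityMeasure_map (measurable_simulate a b t s j).aemeasurable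
  rw [stdNormal, Measure.pi_map_pi (μ := fun _ : Fin 3 × Fin d => gaussianReal 0 1)
    (f := fun l => simulate a b t s l.1) fun l => (measurable_simulate a b t s l.1).aemeasurable]
  -- A product measure is identified by its values on boxes. The probability of a box is factored
  -- first between η and the Brownian motion, then over the coordinates of the latter, then between
  -- the value at t and the increment.
  refine (Measure.pi_eq fun A hA => ?_).symm
  rw [Measure.map_apply_of_aemeasurable hN (.univ_pi hA), Fintype.prod_prod_type,
    Fin.prod_univ_three]
  -- The independence hypotheses concern whole paths, so the events at the times t and s are written
  -- as sets of paths.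
  set S : Fin d → Set (ℝ≥0 → ℝ) := fun k => {q | q t ∈ A (1, k) ∧ q s - q t ∈ A (2, k)} with hS
  have hSm : ∀ k, MeasurableSet (S k) := fun k =>
    ((measurable_pi_apply t) (hA (1, k))).inter
      (((measurable_pi_apply s).sub (measurable_pi_apply t)) (hA (2, k)))
  set Q : Set (ℝ≥0 → Fin d → ℝ) := {q | ∀ k, (fun r => q r k) ∈ S k} with hQ
  have hQm : MeasurableSet Q := by
    have : Q = ⋂ k, (fun q : ℝ≥0 → Fin d → ℝ => fun r => q r k) ⁻¹' S k := by
      ext; simp [hQ]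
    rw [this]
    exact .iInter fun k => (measurable_pi_lambda _ fun r =>
      (measurable_pi_apply k).comp (measurable_pi_apply r)) (hSm k)
  have e1 : drivingNoise η B t s ⁻¹' (Set.univ.pi A) =
      (η ⁻¹' Set.univ.pi fun k => A (0, k)) ∩ ((fun ω r => B r ω) ⁻¹' Q) := by
    ext ω
    simp only [Set.mem_preimage, Set.mem_pi, Set.mem_univ, true_implies, Prod.forall,
      Set.mem_inter_iff, hQ, hS, Set.mem_ofPred_eq, drivingNoise, Fin.forall_fin_succ]
    simp [forall_and]
  rw [e1, h.indep_init.measure_inter_preimage_eq_mul _ _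
    (.univ_pi fun k => hA (0, k)) hQm, mul_assoc]
  congr 1
  · rw [← Measure.map_apply_of_aemeasurable hη (.univ_pi fun k => hA (0, k)),
      show P.map η = _ from h.uniform, cond_Icc_pi d hab]
    have : IsProbabilityMeasure (ProbabilityTheory.cond (volume : Measure ℝ) (Set.Icc a b)) :=
      ProbabilityTheory.cond_isProbabilityMeasure_of_finite
        (by simp [Real.volume_Icc, hab]) (by simp [Real.volume_Icc])
    rw [Measure.pi_pi]
    have : NullSingletonClass (gaussianReal 0 1) := nullSingletonClass_gaussianReal one_ne_zero
    refine Finset.prod_congr rfl fun k _ => ?_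
    rw [← map_cdf_eq_cond (gaussianReal 0 1) hab]
    rfl
  · have e2 : (fun ω r => B r ω) ⁻¹' Q = ⋂ k ∈ (Finset.univ : Finset (Fin d)),
        (fun ω r => B r ω k) ⁻¹' S k := by
      ext ω; simp [hQ]
    rw [e2, (iIndepFun_iff_measure_inter_preimage_eq_mul.1 h.indep_coord) Finset.univ
      (fun k _ => hSm k), ← Finset.prod_mul_distrib]
    refine Finset.prod_congr rfl fun k _ => ?_
    have hb := (h.brownian k).toIsPreBrownianReal
    have e3 : (fun ω r => B r ω k) ⁻¹' S k =
        (fun ω => B t ω k) ⁻¹' A (1, k) ∩ (fun ω => B s ω k - B t ω k) ⁻¹' A (2, k) := by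
      ext; simp [hS]
    have hind : IndepFun (fun ω => B t ω k) (fun ω => B s ω k - B t ω k) P := by
      have m1 : Measurable fun q : ℝ≥0 → ℝ => q (s - t) := measurable_pi_apply _
      have m2 : Measurable fun q : Set.Iic t → ℝ => q ⟨t, Set.mem_Iic.2 le_rfl⟩ :=
        measurable_pi_apply _
      -- The motion restarted at t is evaluated at s - t, and the past up to t at its last time.
      have h1 := (hb.indepFun_shift t).comp m1 m2
      simpa [Function.comp_def, add_tsub_cancel_of_le hts] using h1.symm
    have hBs : AEMeasurable (fun ω => B s ω k - B t ω k) P := (hB s k).sub (hB t k)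
    rw [e3, hind.measure_inter_preimage_eq_mul _ _ (hA _) (hA _),
      ← Measure.map_apply_of_aemeasurable (hB t k) (hA _),
      ← Measure.map_apply_of_aemeasurable hBs (hA _)]
    congr 2
    · exact (hb.hasLaw_eval t).map_eq.trans (map_sqrt_mul_gaussianReal t).symm
    · refine (hb.hasLaw_sub s t).map_eq.trans ?_
      rw [← map_sqrt_mul_gaussianReal]
      congr 1
      ext x
      simp only [simulate, Matrix.cons_val]
      congr 2
      rw [coe_nndist, Real.dist_eq]
      exact abs_of_nonneg (sub_nonneg.2 (NNReal.coe_le_coe.2 hts))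

/-! ### The loss as an integral over the standard normal law -/

/-- The flow property of the exact solutions. The loss runs the process from time 0 to s, whereas a
sample restarts it at X_t; this identifies the two. -/
lemma forwardStep_add {d : ℕ} (M : ForwardModel) (μ σ : ℝ) (x : Fin d → ℝ) (h h' : ℝ)
    (Δ Δ' : Fin d → ℝ) :
    forwardStep M μ σ (fun k => forwardStep M μ σ x h Δ k) h' Δ' =
      forwardStep M μ σ x (h + h') (Δ + Δ') := by
  cases M
  · ext k
    simp only [forwardStep, Pi.add_apply]
    ring
  · ext k
    simp only [forwardStep, Pi.add_apply]
    rw [mul_assoc, ← Real.exp_add]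
    congr 2
    ring

lemma continuous_forwardStep {d : ℕ} {α : Type*} [TopologicalSpace α] (M : ForwardModel)
    (μ σ h : ℝ) {x Δ : α → Fin d → ℝ} (hx : Continuous x) (hΔ : Continuous Δ) :
    Continuous fun y => forwardStep M μ σ (x y) h (Δ y) := by
  cases M <;> exact (PiLp.continuous_toLp 2 _).comp (by fun_prop)

/-- The state `X_t` as a function of the noise vector. -/
def stateOf {d : ℕ} (M : ForwardModel) (μ σ : ℝ) (t : ℝ≥0) (y : Fin 3 × Fin d → ℝ) : State d :=
  forwardStep M μ σ (fun k => y (0, k)) t (fun k => y (1, k))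

/-- The state `X_s` as a function of the noise vector. -/
def nextStateOf {d : ℕ} (M : ForwardModel) (μ σ : ℝ) (t s : ℝ≥0) (y : Fin 3 × Fin d → ℝ) :
    State d :=
  forwardStep M μ σ (fun k => stateOf M μ σ t y k) ((s : ℝ) - t) (fun k => y (2, k))

/-- The residual under the square in the loss, as a function of the noise vector. -/
def residual {d : ℕ} (M : ForwardModel) (μ σ : ℝ) (f : ℝ → State d → ℝ → State d → ℝ)
    (t s : ℝ≥0) (V : State d → ℝ) (U : State d → ℝ) (Z : State d → State d)
    (y : Fin 3 × Fin d → ℝ) : ℝ :=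
  V (nextStateOf M μ σ t s y) - stepF f t (stateOf M μ σ t y) (U (stateOf M μ σ t y))
    (Z (stateOf M μ σ t y)) ((s : ℝ) - t) (fun k => y (2, k))

/-- The noise vector simulated from a standard normal vector. -/
def simulateNoise {d : ℕ} (a b : ℝ) (t s : ℝ≥0) (w : Fin 3 × Fin d → ℝ) (l : Fin 3 × Fin d) : ℝ :=
  simulate a b t s l.1 (w l)

lemma measurable_simulateNoise {d : ℕ} (a b : ℝ) (t s : ℝ≥0) :
    Measurable (simulateNoise (d := d) a b t s) :=
  measurable_pi_lambda _ fun l => (measurable_simulate a b t s l.1).comp (measurable_pi_apply l)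

lemma measurable_stateOf {d : ℕ} (M : ForwardModel) (μ σ : ℝ) (t : ℝ≥0) :
    Measurable (stateOf (d := d) M μ σ t) :=
  (continuous_forwardStep M μ σ t (by fun_prop) (by fun_prop)).measurable

lemma measurable_nextStateOf {d : ℕ} (M : ForwardModel) (μ σ : ℝ) (t s : ℝ≥0) :
    Measurable (nextStateOf (d := d) M μ σ t s) := by
  have h : Continuous (stateOf (d := d) M μ σ t) :=
    continuous_forwardStep M μ σ t (by fun_prop) (by fun_prop)
  exact (continuous_forwardStep M μ σ _ (by fun_prop) (by fun_prop)).measurable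

lemma measurable_residual {d : ℕ} (M : ForwardModel) (μ σ : ℝ)
    {f : ℝ → State d → ℝ → State d → ℝ} {t s : ℝ≥0}
    (hf : Measurable fun p : State d × ℝ × State d => f t p.1 p.2.1 p.2.2)
    {V : State d → ℝ} (hV : Measurable V) {U : State d → ℝ} (hU : Measurable U)
    {Z : State d → State d} (hZ : Measurable Z) :
    Measurable (residual M μ σ f t s V U Z) := by
  have hx := measurable_stateOf (d := d) M μ σ t
  have hx' := measurable_nextStateOf (d := d) M μ σ t s
  have h1 : Measurable fun y => f t (stateOf M μ σ t y) (U (stateOf M μ σ t y))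
      (Z (stateOf M μ σ t y)) := hf.comp (hx.prodMk ((hU.comp hx).prodMk (hZ.comp hx)))
  refine (hV.comp hx').sub (((hU.comp hx).sub (h1.mul_const _)).add ?_)
  refine Finset.measurable_sum _ fun k _ => ?_
  have hc : Measurable fun z : State d => z k := by fun_prop
  exact ((hc.comp hZ).comp hx).mul (measurable_pi_apply _)

lemma forwardProcess_eq_nextStateOf {d : ℕ} {Ω : Type*} {η : Ω → Fin d → ℝ}
    {B : ℝ≥0 → Ω → Fin d → ℝ} (M : ForwardModel) (μ σ : ℝ) (t s : ℝ≥0) (ω : Ω) :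
    forwardProcess M μ σ η B s ω = nextStateOf M μ σ t s (drivingNoise η B t s ω) := by
  rw [nextStateOf, stateOf, forwardStep_add, forwardProcess]
  congr 1
  · ring
  · ext k
    simp [drivingNoise]

section Transfer

variable {d : ℕ} {Ω : Type*} [MeasurableSpace Ω] {P : Measure Ω} [IsProbabilityMeasure P]
  {a b : ℝ} {η : Ω → Fin d → ℝ} {B : ℝ≥0 → Ω → Fin d → ℝ}

/-- Both sides integrate `F` against the common law of the driving noise and the simulated noise. -/
lemma IsDrivingNoise.integral_comp (h : IsDrivingNoise a b η B P) (hab : a < b) {t s : ℝ≥0}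
    (hts : t ≤ s) {F : (Fin 3 × Fin d → ℝ) → ℝ} (hF : Measurable F) :
    ∫ ω, F (drivingNoise η B t s ω) ∂P =
      ∫ w, F (simulateNoise a b t s w) ∂stdNormal d := by
  have hl := h.hasLaw hab hts
  rw [← integral_map hl.aemeasurable hF.aestronglyMeasurable, hl.map_eq]
  exact integral_map (measurable_simulateNoise a b t s).aemeasurable hF.aestronglyMeasurable

lemma IsDrivingNoise.memLp_comp {E : Type*} [NormedAddCommGroup E] [MeasurableSpace E]
    [BorelSpace E] [SecondCountableTopology E] (h : IsDrivingNoise a b η B P) (hab : a < b)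
    {t s : ℝ≥0} (hts : t ≤ s) {F : (Fin 3 × Fin d → ℝ) → E} (hF : Measurable F)
    (hL : MemLp (fun ω => F (drivingNoise η B t s ω)) 2 P) :
    MemLp (fun w => F (simulateNoise a b t s w)) 2 (stdNormal d) := by
  have hl := h.hasLaw hab hts
  have h1 : MemLp F 2 (P.map (drivingNoise η B t s)) :=
    (memLp_map_measure_iff hF.aestronglyMeasurable hl.aemeasurable).2 hL
  rw [hl.map_eq] at h1
  exact (memLp_map_measure_iff hF.aestronglyMeasurable
    (measurable_simulateNoise a b t s).aemeasurable).1 h1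

lemma IsDrivingNoise.loss_eq (h : IsDrivingNoise a b η B P) (hab : a < b) {t s : ℝ≥0}
    (hts : t ≤ s) (M : ForwardModel) (μ σ : ℝ) {f : ℝ → State d → ℝ → State d → ℝ}
    (hf : Measurable fun p : State d × ℝ × State d => f t p.1 p.2.1 p.2.2)
    {V : State d → ℝ} (hV : Measurable V) {U : State d → ℝ} (hU : Measurable U)
    {Z : State d → State d} (hZ : Measurable Z) :
    loss M μ σ η B P f t s V U Z =
      ∫ w, residual M μ σ f t s V U Z (simulateNoise a b t s w) ^ 2 ∂stdNormal d := by
  rw [← h.integral_comp hab hts ((measurable_residual M μ σ hf hV hU hZ).pow_const 2)]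
  unfold loss
  congr 1
  ext ω
  rw [forwardProcess_eq_nextStateOf M μ σ t s ω]
  rfl

end Transfer

/-! ### An envelope for the simulated processes and its moments -/

/-- The envelope `∑ exp (β |w_l|)`. -/
def noiseEnvelope {d : ℕ} (β : ℝ) (w : Fin 3 × Fin d → ℝ) : ℝ :=
  ∑ l, Real.exp (β * |w l|)

lemma measurable_noiseEnvelope {d : ℕ} (β : ℝ) : Measurable (noiseEnvelope (d := d) β) := by
  unfold noiseEnvelope
  fun_prop

lemma one_le_noiseEnvelope {d : ℕ} (hd : 0 < d) {β : ℝ} (hβ : 0 ≤ β) (w : Fin 3 × Fin d → ℝ) :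
    1 ≤ noiseEnvelope β w := by
  have h : Real.exp (β * |w (0, ⟨0, hd⟩)|) ≤ noiseEnvelope β w :=
    Finset.single_le_sum (f := fun l => Real.exp (β * |w l|)) (fun l _ => (Real.exp_pos _).le)
      (Finset.mem_univ _)
  exact (Real.one_le_exp (by positivity)).trans h

lemma norm_state_le_sum {d : ℕ} (x : State d) : ‖x‖ ≤ ∑ k, |x k| := by
  rw [EuclideanSpace.norm_eq]
  refine Real.sqrt_le_iff.2 ⟨Finset.sum_nonneg fun k _ => abs_nonneg _, ?_⟩
  simp only [Real.norm_eq_abs]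
  exact Finset.sum_sq_le_sq_sum_of_nonneg fun k _ => abs_nonneg _

lemma abs_coord_le_norm {d : ℕ} (x : State d) (k : Fin d) : |x k| ≤ ‖x‖ := by
  simpa using PiLp.norm_apply_le x k

/-- One bound for both models. In the additive model the drift and noise are at most u ≤ exp u; in
the geometric one the correction -σ²/2 only lowers the exponent. -/
lemma abs_forwardStep_le {d : ℕ} (M : ForwardModel) (μ σ : ℝ) (x : Fin d → ℝ) {h : ℝ}
    (hh : 0 ≤ h) (Δ : Fin d → ℝ) (k : Fin d) :
    |forwardStep M μ σ x h Δ k| ≤ (|x k| + 1) * Real.exp (|μ| * h + |σ| * |Δ k|) := by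
  set u := |μ| * h + |σ| * |Δ k| with hu
  have h1 : 1 ≤ Real.exp u := Real.one_le_exp (by positivity)
  cases M
  · have h2 : |μ * h| = |μ| * h := by rw [abs_mul, abs_of_nonneg hh]
    have h3 : u ≤ Real.exp u := by linarith [Real.add_one_le_exp u]
    calc |x k + μ * h + σ * Δ k| ≤ |x k| + |μ * h| + |σ * Δ k| := abs_add_three _ _ _
      _ = |x k| + u := by rw [h2, abs_mul, hu, add_assoc]
      _ ≤ (|x k| + 1) * Real.exp u := by nlinarith [abs_nonneg (x k)]
  · have h2 : (μ - σ ^ 2 / 2) * h + σ * Δ k ≤ u := by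
      have h3 : σ * Δ k ≤ |σ| * |Δ k| := (le_abs_self _).trans (abs_mul _ _).le
      have h4 : μ * h ≤ |μ| * h := by gcongr; exact le_abs_self _
      have h5 : 0 ≤ σ ^ 2 / 2 * h := by positivity
      rw [hu]
      linarith
    calc |x k * Real.exp ((μ - σ ^ 2 / 2) * h + σ * Δ k)|
        = |x k| * Real.exp ((μ - σ ^ 2 / 2) * h + σ * Δ k) := by rw [abs_mul, Real.abs_exp]
      _ ≤ |x k| * Real.exp u := by gcongr
      _ ≤ (|x k| + 1) * Real.exp u := by nlinarith

/-- The simulated states and Brownian increments are dominated by the envelope. -/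
lemma exists_noise_bound (T μ σ a b : ℝ) (hT : 0 ≤ T) (hab : a ≤ b) :
    ∃ β c : ℝ, 0 ≤ β ∧ 1 ≤ c ∧ ∀ (M : ForwardModel) (d : ℕ) (t s : ℝ≥0), t ≤ s → (s : ℝ) ≤ T →
      ∀ w : Fin 3 × Fin d → ℝ,
        ‖stateOf M μ σ t (simulateNoise a b t s w)‖ ≤ c * noiseEnvelope β w ∧
        ‖nextStateOf M μ σ t s (simulateNoise a b t s w)‖ ≤ c * noiseEnvelope β w ∧
        ‖(WithLp.toLp 2 fun k => simulateNoise a b t s w (2, k) : State d)‖ ≤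
          c * noiseEnvelope β w := by
  -- This dominates both |σ| √T, for the exponents of the states, and √T, for the increment itself.
  set γ := (1 + |σ|) * Real.sqrt T with hγ
  set c₀ := |a| + |b| with hc₀
  set c := (c₀ + 2) * Real.exp (|μ| * T) with hc
  have hγ0 : 0 ≤ γ := by positivity
  have hc00 : 0 ≤ c₀ := by positivity
  have hc1 : 1 ≤ c := by
    have : 1 ≤ Real.exp (|μ| * T) := Real.one_le_exp (by positivity)
    nlinarith
  -- The factor 2 turns the product of the exponentials at times t and s into a sum, by xy ≤ x² +
  -- y². The coordinates behind η enter only through the bounded distribution function, so their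
  -- terms in the envelope are slack.
  refine ⟨2 * γ, c, by positivity, hc1, fun M d t s hts hsT w => ?_⟩
  set y := simulateNoise a b t s w with hy
  have hts' : (t : ℝ) ≤ s := NNReal.coe_le_coe.2 hts
  have ht0 : (0 : ℝ) ≤ t := t.2
  have y0 : ∀ k, |y (0, k)| ≤ c₀ := fun k => by
    have e : y (0, k) = (b - a) * cdf (gaussianReal 0 1) (w (0, k)) + a := rfl
    have p0 := cdf_nonneg (gaussianReal 0 1) (w (0, k))
    have p1 := cdf_le_one (gaussianReal 0 1) (w (0, k))
    rw [e, abs_le]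
    have := neg_abs_le a
    have := le_abs_self a
    have := neg_abs_le b
    have := le_abs_self b
    constructor <;> nlinarith
  have y1 : ∀ k, |y (1, k)| ≤ Real.sqrt T * |w (1, k)| := fun k => by
    have e : y (1, k) = Real.sqrt t * w (1, k) := rfl
    rw [e, abs_mul, abs_of_nonneg (Real.sqrt_nonneg _)]
    gcongr
    exact hts'.trans hsT
  have y2 : ∀ k, |y (2, k)| ≤ Real.sqrt T * |w (2, k)| := fun k => by
    have e : y (2, k) = Real.sqrt ((s : ℝ) - t) * w (2, k) := rfl
    rw [e, abs_mul, abs_of_nonneg (Real.sqrt_nonneg _)]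
    gcongr
    linarith
  set g : Fin d → ℝ := fun k => Real.exp (γ * |w (1, k)| + γ * |w (2, k)|) with hg
  have hsum : ∀ z : State d, (∀ k, |z k| ≤ c * g k) → ‖z‖ ≤ c * noiseEnvelope (2 * γ) w := by
    intro z hz
    refine (norm_state_le_sum z).trans ?_
    refine (Finset.sum_le_sum fun k _ => hz k).trans ?_
    rw [← Finset.mul_sum]
    gcongr
    rw [noiseEnvelope, Fintype.sum_prod_type, Fin.sum_univ_three]
    have h1 : ∑ k, g k ≤
        ∑ k, (Real.exp (2 * γ * |w (1, k)|) + Real.exp (2 * γ * |w (2, k)|)) := by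
      refine Finset.sum_le_sum fun k _ => ?_
      have e1 : Real.exp (2 * γ * |w (1, k)|) = Real.exp (γ * |w (1, k)|) ^ 2 := by
        rw [← Real.exp_nat_mul]; congr 1; push_cast; ring
      have e2 : Real.exp (2 * γ * |w (2, k)|) = Real.exp (γ * |w (2, k)|) ^ 2 := by
        rw [← Real.exp_nat_mul]; congr 1; push_cast; ring
      rw [hg, e1, e2]
      simp only [Real.exp_add]
      nlinarith [sq_nonneg (Real.exp (γ * |w (1, k)|) - Real.exp (γ * |w (2, k)|)),
        sq_nonneg (Real.exp (γ * |w (1, k)|)), sq_nonneg (Real.exp (γ * |w (2, k)|))]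
    rw [Finset.sum_add_distrib] at h1
    have h0 : 0 ≤ ∑ k, Real.exp (2 * γ * |w (0, k)|) :=
      Finset.sum_nonneg fun k _ => (Real.exp_pos _).le
    linarith
  have hσγ : |σ| * Real.sqrt T ≤ γ := by
    rw [hγ]
    have := Real.sqrt_nonneg T
    nlinarith
  have hTγ : Real.sqrt T ≤ γ := by
    rw [hγ]
    have := Real.sqrt_nonneg T
    have := abs_nonneg σ
    nlinarith
  have u1 : ∀ k, |σ| * |y (1, k)| ≤ γ * |w (1, k)| := fun k => by
    calc |σ| * |y (1, k)| ≤ |σ| * (Real.sqrt T * |w (1, k)|) := by gcongr; exact y1 k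
      _ = (|σ| * Real.sqrt T) * |w (1, k)| := by ring
      _ ≤ γ * |w (1, k)| := by gcongr
  have u2 : ∀ k, |σ| * |y (2, k)| ≤ γ * |w (2, k)| := fun k => by
    calc |σ| * |y (2, k)| ≤ |σ| * (Real.sqrt T * |w (2, k)|) := by gcongr; exact y2 k
      _ = (|σ| * Real.sqrt T) * |w (2, k)| := by ring
      _ ≤ γ * |w (2, k)| := by gcongr
  have x1 : ∀ k, |stateOf M μ σ t y k| ≤
      (c₀ + 1) * Real.exp (|μ| * t + γ * |w (1, k)|) := fun k => by
    refine (abs_forwardStep_le M μ σ _ ht0 _ k).trans ?_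
    refine mul_le_mul ?_ (Real.exp_le_exp.2 ?_) (Real.exp_pos _).le (by positivity)
    · linarith [y0 k]
    · linarith [u1 k]
  have hcg : ∀ k, c * g k =
      (c₀ + 2) * Real.exp (|μ| * T + (γ * |w (1, k)| + γ * |w (2, k)|)) := fun k => by
    rw [hc, hg, mul_assoc, ← Real.exp_add]
  refine ⟨hsum _ fun k => ?_, hsum _ fun k => ?_, hsum _ fun k => ?_⟩
  · refine (x1 k).trans ?_
    rw [hcg]
    have : |μ| * t ≤ |μ| * T := by gcongr; linarith
    have : 0 ≤ γ * |w (2, k)| := by positivity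
    gcongr ?_ * Real.exp ?_ <;> linarith
  · refine (abs_forwardStep_le M μ σ _ (sub_nonneg.2 hts') _ k).trans ?_
    rw [hcg]
    have h1 : 1 ≤ Real.exp (|μ| * t + γ * |w (1, k)|) := Real.one_le_exp (by positivity)
    calc (|stateOf M μ σ t y k| + 1) * Real.exp (|μ| * ((s : ℝ) - t) + |σ| * |y (2, k)|)
        ≤ ((c₀ + 2) * Real.exp (|μ| * t + γ * |w (1, k)|)) *
            Real.exp (|μ| * ((s : ℝ) - t) + γ * |w (2, k)|) := by
          refine mul_le_mul ?_ (Real.exp_le_exp.2 ?_) (Real.exp_pos _).le (by positivity)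
          · linarith [x1 k]
          · linarith [u2 k]
      _ = (c₀ + 2) * Real.exp (|μ| * s + (γ * |w (1, k)| + γ * |w (2, k)|)) := by
          rw [mul_assoc, ← Real.exp_add]; congr 2; ring
      _ ≤ _ := by gcongr
  · refine (y2 k).trans ?_
    have h0 : γ * |w (2, k)| ≤ Real.exp (γ * |w (2, k)|) := by
      linarith [Real.add_one_le_exp (γ * |w (2, k)|)]
    have h1 : Real.exp (γ * |w (2, k)|) ≤ g k := by
      rw [hg]
      have : 0 ≤ γ * |w (1, k)| := by positivity
      simp only [Real.exp_le_exp]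
      linarith
    have h2 : Real.sqrt T * |w (2, k)| ≤ γ * |w (2, k)| := by gcongr
    have h3 : 0 ≤ g k := (Real.exp_pos _).le
    nlinarith

lemma integrable_exp_mul_abs_gaussian (β : ℝ) (hβ : 0 ≤ β) :
    Integrable (fun x => Real.exp (β * |x|)) (gaussianReal 0 1) := by
  have h := integrable_exp_abs_mul_abs (X := fun x : ℝ => x) (μ := gaussianReal 0 1) (t := β)
    (integrable_exp_mul_gaussianReal β) (integrable_exp_mul_gaussianReal (-β))
  rwa [abs_of_nonneg hβ] at h

/-- The residual is bounded by the square of this envelope, and the fourth moment of that bound is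
needed; hence the power 8. Convexity of x ↦ x⁸ keeps the dependence on d polynomial. -/
lemma noiseEnvelope_moment {d : ℕ} (β : ℝ) (hβ : 0 ≤ β) :
    Integrable (fun w => noiseEnvelope β w ^ 8) (stdNormal d) ∧
      ∫ w, noiseEnvelope β w ^ 8 ∂stdNormal d ≤
        (∫ x, Real.exp (8 * β * |x|) ∂gaussianReal 0 1) * (3 * d) ^ 8 := by
  have hi := integrable_exp_mul_abs_gaussian (8 * β) (by positivity)
  have hmp : ∀ l : Fin 3 × Fin d, MeasurePreserving (Function.eval l) (stdNormal d)
      (gaussianReal 0 1) := fun l => measurePreserving_eval _ l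
  have hpow : ∀ x : ℝ, Real.exp (β * |x|) ^ 8 = Real.exp (8 * β * |x|) := fun x => by
    rw [← Real.exp_nat_mul]; congr 1; push_cast; ring
  have hil : ∀ l : Fin 3 × Fin d, Integrable (fun w : Fin 3 × Fin d → ℝ =>
      Real.exp (β * |w l|) ^ 8) (stdNormal d) := fun l => by
    simp_rw [hpow]
    exact (hmp l).integrable_comp_of_integrable hi
  have hint : ∀ l : Fin 3 × Fin d, ∫ w, Real.exp (β * |w l|) ^ 8 ∂stdNormal d =
      ∫ x, Real.exp (8 * β * |x|) ∂gaussianReal 0 1 := fun l => by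
    simp_rw [hpow]
    rw [← (hmp l).map_eq, integral_map (hmp l).measurable.aemeasurable
      (Measurable.aestronglyMeasurable (by fun_prop))]
  have hle : ∀ w : Fin 3 × Fin d → ℝ, noiseEnvelope β w ^ 8 ≤
      (3 * d) ^ 7 * ∑ l, Real.exp (β * |w l|) ^ 8 := fun w => by
    have h := pow_sum_le_card_mul_sum_pow (s := (Finset.univ : Finset (Fin 3 × Fin d)))
      (f := fun l => Real.exp (β * |w l|)) (fun l _ => (Real.exp_pos _).le) 7
    have hcard : ((Finset.univ : Finset (Fin 3 × Fin d)).card : ℝ) = 3 * d := by simp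
    rwa [hcard] at h
  have hsi : Integrable (fun w : Fin 3 × Fin d → ℝ =>
      ((3 : ℝ) * d) ^ 7 * ∑ l, Real.exp (β * |w l|) ^ 8) (stdNormal d) :=
    (integrable_finsetSum _ fun l _ => hil l).const_mul _
  have he0 : ∀ w : Fin 3 × Fin d → ℝ, 0 ≤ noiseEnvelope β w := fun w =>
    Finset.sum_nonneg fun l _ => (Real.exp_pos _).le
  have hI : Integrable (fun w => noiseEnvelope β w ^ 8) (stdNormal d) := by
    refine hsi.mono' ((measurable_noiseEnvelope β).pow_const 8).aestronglyMeasurable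
      (.of_forall fun w => ?_)
    rw [Real.norm_eq_abs, abs_of_nonneg (pow_nonneg (he0 w) 8)]
    exact hle w
  refine ⟨hI, (integral_mono hI hsi hle).trans (le_of_eq ?_)⟩
  rw [integral_const_mul, integral_finsetSum _ fun l _ => hil l]
  simp_rw [hint]
  simp only [Finset.sum_const, Finset.card_univ, Fintype.card_prod, Fintype.card_fin,
    nsmul_eq_mul, Nat.cast_mul, Nat.cast_ofNat]
  ring

/-! ### Pointwise bounds for the residual -/

lemma abs_sum_mul_le {d : ℕ} (z : State d) (Δ : Fin d → ℝ) :
    |∑ k, z k * Δ k| ≤ ‖z‖ * ‖(WithLp.toLp 2 Δ : State d)‖ := by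
  have h := abs_real_inner_le_norm (WithLp.toLp 2 Δ : State d) z
  rw [PiLp.inner_apply] at h
  refine le_trans (le_of_eq ?_) (h.trans_eq (mul_comm _ _))
  simp [mul_comm]

/-- Bound for the residual in terms of a common bound `Y` for all growth constants and of an
envelope `c e` for the states and the increment. -/
lemma abs_residual_le {d : ℕ} {M : ForwardModel} {μ σ : ℝ} {f : ℝ → State d → ℝ → State d → ℝ}
    {t s : ℝ≥0} {V U : State d → ℝ} {Z : State d → State d} {y : Fin 3 × Fin d → ℝ} {Y e : ℝ}
    (hY : 1 ≤ Y) (he : 1 ≤ e) (hts : t ≤ s) (hst : (s : ℝ) - t ≤ Y)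
    (hV : ∀ x, |V x| ≤ Y * (1 + ‖x‖)) (hU : ∀ x, |U x| ≤ Y * (1 + ‖x‖))
    (hZ : ∀ x, ‖Z x‖ ≤ Y * (1 + ‖x‖))
    (hf : ∀ x y z, |f t x y z| ≤ Y * (1 + ‖x‖ + |y| + ‖z‖))
    (hx : ‖stateOf M μ σ t y‖ ≤ Y * e) (hx' : ‖nextStateOf M μ σ t s y‖ ≤ Y * e)
    (hΔ : ‖(WithLp.toLp 2 fun k => y (2, k) : State d)‖ ≤ Y * e) :
    |residual M μ σ f t s V U Z y| ≤ 12 * Y ^ 4 * e ^ 2 := by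
  set x := stateOf M μ σ t y with hxdef
  set x' := nextStateOf M μ σ t s y
  have hh : 0 ≤ (s : ℝ) - t := sub_nonneg.2 (NNReal.coe_le_coe.2 hts)
  have hYe : 1 ≤ Y * e := one_le_mul_of_one_le_of_one_le hY he
  have a1 : |V x'| ≤ 2 * (Y * (Y * e)) := by
    refine (hV x').trans ?_
    nlinarith
  have a2 : |U x| ≤ 2 * (Y * (Y * e)) := by
    refine (hU x).trans ?_
    nlinarith
  have a3 : ‖Z x‖ ≤ 2 * (Y * (Y * e)) := by
    refine (hZ x).trans ?_
    nlinarith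
  have a4 : |f t x (U x) (Z x)| ≤ Y * (6 * (Y * (Y * e))) := by
    refine (hf x (U x) (Z x)).trans ?_
    gcongr
    have : Y * e ≤ Y * (Y * e) := le_mul_of_one_le_left (by linarith) hY
    linarith
  have a5 : |f t x (U x) (Z x) * ((s : ℝ) - t)| ≤ Y * (6 * (Y * (Y * e))) * Y := by
    rw [abs_mul, abs_of_nonneg hh]
    gcongr
  have a6 : |∑ k, Z x k * y (2, k)| ≤ 2 * (Y * (Y * e)) * (Y * e) := by
    refine (abs_sum_mul_le (Z x) fun k => y (2, k)).trans ?_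
    gcongr
  have key : residual M μ σ f t s V U Z y = V x' - U x + f t x (U x) (Z x) * ((s : ℝ) - t)
      - ∑ k, Z x k * y (2, k) := by
    simp only [residual, stepF]
    ring
  have b1 : Y * (Y * e) ≤ Y ^ 4 * e ^ 2 := by
    have : Y ^ 2 * e ^ 1 ≤ Y ^ 4 * e ^ 2 := by
      gcongr <;> norm_num
    nlinarith
  have b2 : Y * (Y * (Y * e)) * Y ≤ Y ^ 4 * e ^ 2 := by
    have : Y ^ 4 * e ^ 1 ≤ Y ^ 4 * e ^ 2 := by
      gcongr
      norm_num
    nlinarith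
  have b3 : Y * (Y * e) * (Y * e) ≤ Y ^ 4 * e ^ 2 := by
    have : Y ^ 3 * e ^ 2 ≤ Y ^ 4 * e ^ 2 := by
      gcongr
      norm_num
    nlinarith
  -- The four terms contribute 2 + 2 + 6 + 2 = 12. The square of `e` comes from the product of Z
  -- with the increment.
  rw [key]
  have t1 := abs_sub (V x' - U x + f t x (U x) (Z x) * ((s : ℝ) - t)) (∑ k, Z x k * y (2, k))
  have t2 := abs_add_le (V x' - U x) (f t x (U x) (Z x) * ((s : ℝ) - t))
  have t3 := abs_sub (V x') (U x)
  linarith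

/-- Dependence of the residual on the pair `(U, Z)`. -/
lemma abs_residual_sub_le {d : ℕ} {M : ForwardModel} {μ σ : ℝ}
    {f : ℝ → State d → ℝ → State d → ℝ} {t s : ℝ≥0} {V U U' : State d → ℝ}
    {Z Z' : State d → State d} {y : Fin 3 × Fin d → ℝ} {Y : ℝ} (hY : 0 ≤ Y) (hts : t ≤ s)
    (hst : (s : ℝ) - t ≤ Y)
    (hf : ∀ x y y' z z', |f t x y z - f t x y' z'| ≤ Y * (|y - y'| + ‖z - z'‖)) :
    |residual M μ σ f t s V U Z y - residual M μ σ f t s V U' Z' y| ≤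
      (1 + Y ^ 2) * |U (stateOf M μ σ t y) - U' (stateOf M μ σ t y)| +
      (Y ^ 2 + ‖(WithLp.toLp 2 fun k => y (2, k) : State d)‖) *
        ‖Z (stateOf M μ σ t y) - Z' (stateOf M μ σ t y)‖ := by
  set x := stateOf M μ σ t y with hxdef
  have hh : 0 ≤ (s : ℝ) - t := sub_nonneg.2 (NNReal.coe_le_coe.2 hts)
  have key : residual M μ σ f t s V U Z y - residual M μ σ f t s V U' Z' y =
      -(U x - U' x) + (f t x (U x) (Z x) - f t x (U' x) (Z' x)) * ((s : ℝ) - t)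
      - ∑ k, (Z x - Z' x) k * y (2, k) := by
    simp only [residual, stepF, PiLp.sub_apply, sub_mul, Finset.sum_sub_distrib]
    ring
  have a1 : |(f t x (U x) (Z x) - f t x (U' x) (Z' x)) * ((s : ℝ) - t)| ≤
      Y * (|U x - U' x| + ‖Z x - Z' x‖) * Y := by
    rw [abs_mul, abs_of_nonneg hh]
    gcongr
    exact hf _ _ _ _ _
  have a2 := abs_sum_mul_le (Z x - Z' x) fun k => y (2, k)
  rw [key]
  have t1 := abs_sub (-(U x - U' x) + (f t x (U x) (Z x) - f t x (U' x) (Z' x)) * ((s : ℝ) - t))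
    (∑ k, (Z x - Z' x) k * y (2, k))
  have t2 := abs_add_le (-(U x - U' x))
    ((f t x (U x) (Z x) - f t x (U' x) (Z' x)) * ((s : ℝ) - t))
  rw [abs_neg] at t2
  nlinarith

/-! ### Bounds for the coefficients and the networks as functions of the state -/

section Coefficients

variable {d : ℕ} {T Cf Cg : ℝ} {f : ℝ → State d → ℝ → State d → ℝ} {g : State d → ℝ}

/-- From 2|x| ≤ 1 + x². It recovers C_f, C_g, f(0) and g(0) from their squares in C_fg without a
square root, so the bounds stay polynomial. -/
lemma abs_le_one_add_of_sq_le {x C : ℝ} (h : x ^ 2 ≤ C) : |x| ≤ 1 + C := by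
  rw [← sq_abs] at h
  nlinarith [sq_nonneg (|x| - 1)]

lemma coefConst_nonneg (Cf Cg : ℝ) (f : ℝ → State d → ℝ → State d → ℝ) (g : State d → ℝ) :
    0 ≤ coefConst Cf Cg f g :=
  (sq_nonneg Cf).trans ((le_max_left _ _).trans (le_max_left _ _))

lemma LipschitzCoefficients.driver_le (h : LipschitzCoefficients T Cf Cg f g) {t : ℝ}
    (ht : t ∈ Set.Icc 0 T) (x : State d) (y : ℝ) (z : State d) :
    |f t x y z| ≤ (1 + coefConst Cf Cg f g) * (2 + T) * (1 + ‖x‖ + |y| + ‖z‖) := by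
  set C := coefConst Cf Cg f g with hC
  have hC0 : 0 ≤ C := coefConst_nonneg Cf Cg f g
  have hT : 0 ≤ T := ht.1.trans ht.2
  have h1 : Cf ≤ 1 + C := (le_abs_self _).trans
    (abs_le_one_add_of_sq_le ((le_max_left _ _).trans (le_max_left _ _)))
  have h2 : |f 0 0 0 0| ≤ 1 + C :=
    abs_le_one_add_of_sq_le ((le_max_left _ _).trans (le_max_right _ _))
  have h3 := h.driver t ht 0 ⟨le_rfl, hT⟩ x 0 y 0 z 0
  simp only [sub_zero] at h3
  have h4 : Real.sqrt |t| ≤ 1 + T := by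
    rw [abs_of_nonneg ht.1]
    refine Real.sqrt_le_iff.2 ⟨by linarith, ?_⟩
    have := ht.2
    nlinarith
  have h5 : |f t x y z| ≤ |f 0 0 0 0| + |f t x y z - f 0 0 0 0| := by
    have := abs_add_le (f 0 0 0 0) (f t x y z - f 0 0 0 0)
    simpa using this
  have hN : 0 ≤ ‖x‖ + |y| + ‖z‖ := by positivity
  calc |f t x y z| ≤ (1 + C) + (1 + C) * ((1 + T) + ‖x‖ + |y| + ‖z‖) := by
        refine h5.trans (add_le_add h2 (h3.trans ?_))
        gcongr
    _ = (1 + C) * ((2 + T) + (‖x‖ + |y| + ‖z‖)) := by ring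
    _ ≤ (1 + C) * ((2 + T) * (1 + ‖x‖ + |y| + ‖z‖)) := by
        gcongr
        nlinarith
    _ = _ := by ring

lemma LipschitzCoefficients.driver_sub_le (h : LipschitzCoefficients T Cf Cg f g) {t : ℝ}
    (ht : t ∈ Set.Icc 0 T) (x : State d) (y y' : ℝ) (z z' : State d) :
    |f t x y z - f t x y' z'| ≤ (1 + coefConst Cf Cg f g) * (|y - y'| + ‖z - z'‖) := by
  have h1 : Cf ≤ 1 + coefConst Cf Cg f g := (le_abs_self _).trans
    (abs_le_one_add_of_sq_le ((le_max_left _ _).trans (le_max_left _ _)))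
  have h3 := h.driver t ht t ht x x y y' z z'
  simp only [sub_self, abs_zero, Real.sqrt_zero, norm_zero, zero_add] at h3
  exact h3.trans (by gcongr)

/-- At a fixed time the driver is Lipschitz. The factor 3 appears because the product carries the
maximum distance. -/
lemma LipschitzCoefficients.measurable_driver (h : LipschitzCoefficients T Cf Cg f g) {t : ℝ}
    (ht : t ∈ Set.Icc 0 T) : Measurable fun p : State d × ℝ × State d => f t p.1 p.2.1 p.2.2 := by
  have hL : LipschitzWith (Real.toNNReal (3 * Cf))
      fun p : State d × ℝ × State d => f t p.1 p.2.1 p.2.2 := by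
    refine LipschitzWith.of_dist_le_mul fun p q => ?_
    have hCf := h.Cf_nonneg
    rw [Real.coe_toNNReal _ (by positivity), Real.dist_eq]
    have h3 := h.driver t ht t ht p.1 q.1 p.2.1 q.2.1 p.2.2 q.2.2
    simp only [sub_self, abs_zero, Real.sqrt_zero, zero_add] at h3
    have d1 : ‖p.1 - q.1‖ ≤ dist p q := (dist_eq_norm p.1 q.1).symm.trans_le (le_max_left _ _)
    have d2 : |p.2.1 - q.2.1| ≤ dist p q :=
      (Real.dist_eq _ _).symm.trans_le ((le_max_left _ _).trans (le_max_right _ _))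
    have d3 : ‖p.2.2 - q.2.2‖ ≤ dist p q :=
      (dist_eq_norm p.2.2 q.2.2).symm.trans_le ((le_max_right _ _).trans (le_max_right _ _))
    calc _ ≤ _ := h3
      _ ≤ Cf * (dist p q + dist p q + dist p q) := by gcongr
      _ = _ := by ring
  exact hL.continuous.measurable

lemma LipschitzCoefficients.measurable_terminal (h : LipschitzCoefficients T Cf Cg f g) :
    Measurable g := by
  have hL : LipschitzWith (Real.toNNReal Cg) g := LipschitzWith.of_dist_le_mul fun p q => by
    rw [Real.coe_toNNReal _ h.Cg_nonneg, Real.dist_eq, dist_eq_norm]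
    exact h.terminal p q
  exact hL.continuous.measurable

lemma LipschitzCoefficients.terminal_le (h : LipschitzCoefficients T Cf Cg f g) (x : State d) :
    |g x| ≤ (1 + coefConst Cf Cg f g) * (1 + ‖x‖) := by
  have h1 : Cg ≤ 1 + coefConst Cf Cg f g := (le_abs_self _).trans
    (abs_le_one_add_of_sq_le ((le_max_right _ _).trans (le_max_left _ _)))
  have h2 : |g 0| ≤ 1 + coefConst Cf Cg f g :=
    abs_le_one_add_of_sq_le ((le_max_right _ _).trans (le_max_right _ _))
  have h3 := h.terminal x 0
  rw [sub_zero] at h3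
  have h5 : |g x| ≤ |g 0| + |g x - g 0| := by
    have := abs_add_le (g 0) (g x - g 0)
    simpa using this
  calc |g x| ≤ (1 + coefConst Cf Cg f g) + (1 + coefConst Cf Cg f g) * ‖x‖ :=
        h5.trans (add_le_add h2 (h3.trans (by gcongr)))
    _ = _ := by ring

variable {hs : List ℕ}

lemma abs_netU_le {θ : ParamIdx d hs 1 → ℝ} {w R : ℝ} (hw : (netWidth d hs 1 : ℝ) ≤ w)
    (hθ : ‖θ‖ ≤ R) (x : State d) : |netU θ x| ≤ R * (w + 1) * (1 + ‖x‖) :=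
  abs_netEval_le hs hw (by linarith [norm_nonneg x]) (fun l => (norm_le_pi_norm θ l).trans hθ)
    (fun c => (abs_coord_le_norm x c).trans (by linarith)) 0

/-- The output dimension d is already counted as the input dimension, so the size of the scalar
structure controls the vector-valued one as well. -/
lemma netWidth_self_le (d : ℕ) (hs : List ℕ) : netWidth d hs d ≤ netWidth d hs 1 := by
  have h : ∀ l : List ℕ, l.foldr max d ≤ max d (l.foldr max 1) := fun l => by
    induction l with
    | nil => simp
    | cons h l ih => simp only [List.foldr_cons]; omega
  have := h hs
  simp only [netWidth]
  omega

lemma norm_netZ_le {θ : ParamIdx d hs d → ℝ} {w R : ℝ} (hw : (netWidth d hs 1 : ℝ) ≤ w)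
    (hθ : ‖θ‖ ≤ R) (x : State d) : ‖netZ θ x‖ ≤ d * (R * (w + 1)) * (1 + ‖x‖) := by
  refine (norm_state_le_sum _).trans ?_
  calc ∑ k, |netZ θ x k| ≤ ∑ _k : Fin d, R * (w + 1) * (1 + ‖x‖) :=
        Finset.sum_le_sum fun k _ => abs_netEval_le hs
          (le_trans (by exact_mod_cast netWidth_self_le d hs) hw)
          (by linarith [norm_nonneg x]) (fun l => (norm_le_pi_norm θ l).trans hθ)
          (fun c => (abs_coord_le_norm x c).trans (by linarith)) k
    _ = _ := by simp [mul_assoc]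

lemma abs_netU_sub_le {θ θ' : ParamIdx d hs 1 → ℝ} {w R κ : ℝ}
    (hw : (netWidth d hs 1 : ℝ) ≤ w) (hθ : ‖θ‖ ≤ R) (hθθ : ‖θ - θ'‖ ≤ κ) (x : State d) :
    |netU θ x - netU θ' x| ≤ ((w + 1) * (R + 1)) ^ netDepth hs * κ * (1 + ‖x‖) := by
  have hx : 0 ≤ ‖x‖ := norm_nonneg x
  have hκ : 0 ≤ κ := (norm_nonneg _).trans hθθ
  refine (abs_netEval_sub_le hs (C := 1) (X := 1 + ‖x‖) (κ := κ) hw (by linarith) le_rfl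
    ((norm_nonneg θ).trans hθ) (fun l => (norm_le_pi_norm θ l).trans hθ)
    (fun l => (norm_le_pi_norm (θ - θ') l).trans hθθ)
    (fun c => (abs_coord_le_norm x c).trans (by linarith))
    (fun c => by rw [sub_self, abs_zero]; positivity) 0).trans (le_of_eq (by ring))

lemma norm_netZ_sub_le {θ θ' : ParamIdx d hs d → ℝ} {w R κ : ℝ}
    (hw : (netWidth d hs 1 : ℝ) ≤ w) (hθ : ‖θ‖ ≤ R) (hθθ : ‖θ - θ'‖ ≤ κ) (x : State d) :
    ‖netZ θ x - netZ θ' x‖ ≤ d * ((w + 1) * (R + 1)) ^ netDepth hs * κ * (1 + ‖x‖) := by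
  have hx : 0 ≤ ‖x‖ := norm_nonneg x
  have hκ : 0 ≤ κ := (norm_nonneg _).trans hθθ
  refine (norm_state_le_sum _).trans ?_
  calc ∑ k, |(netZ θ x - netZ θ' x) k|
      ≤ ∑ _k : Fin d, ((w + 1) * (R + 1)) ^ netDepth hs * 1 * (1 + ‖x‖) * κ :=
        Finset.sum_le_sum fun k _ => abs_netEval_sub_le hs (C := 1) (X := 1 + ‖x‖) (κ := κ)
          (le_trans (by exact_mod_cast netWidth_self_le d hs) hw) (by linarith) le_rfl
          ((norm_nonneg θ).trans hθ) (fun l => (norm_le_pi_norm θ l).trans hθ)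
          (fun l => (norm_le_pi_norm (θ - θ') l).trans hθθ)
          (fun c => (abs_coord_le_norm x c).trans (by linarith))
          (fun c => by rw [sub_self, abs_zero]; positivity) k
    _ = _ := by simp; ring

end Coefficients

/-! ### The approximation error -/

/-- `Y` bounds all the constants of one time step: the growth and Lipschitz constants of the
driver and of the next value function, and the moments of the envelope of the forward process. -/
structure StepBound {d : ℕ} (M : ForwardModel) (μ σ a b β : ℝ)
    (f : ℝ → State d → ℝ → State d → ℝ) (t s : ℝ≥0) (V : State d → ℝ) (Y : ℝ) : Prop where
  two_le : 2 ≤ Y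
  dim_pos : 0 < d
  dim_le : (d : ℝ) ≤ Y
  time_le : t ≤ s
  step_le : (s : ℝ) - t ≤ Y
  exponent_nonneg : 0 ≤ β
  state_le : ∀ w : Fin 3 × Fin d → ℝ,
    ‖stateOf M μ σ t (simulateNoise a b t s w)‖ ≤ Y * noiseEnvelope β w
  next_le : ∀ w : Fin 3 × Fin d → ℝ,
    ‖nextStateOf M μ σ t s (simulateNoise a b t s w)‖ ≤ Y * noiseEnvelope β w
  increment_le : ∀ w : Fin 3 × Fin d → ℝ,
    ‖(WithLp.toLp 2 fun k => simulateNoise a b t s w (2, k) : State d)‖ ≤ Y * noiseEnvelope β w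
  moment_le : ∫ w, noiseEnvelope β w ^ 8 ∂stdNormal d ≤ Y
  measurable_driver : Measurable fun p : State d × ℝ × State d => f t p.1 p.2.1 p.2.2
  measurable_next : Measurable V
  driver_le : ∀ x y z, |f t x y z| ≤ Y * (1 + ‖x‖ + |y| + ‖z‖)
  driver_sub_le : ∀ x y y' z z', |f t x y z - f t x y' z'| ≤ Y * (|y - y'| + ‖z - z'‖)
  next_value_le : ∀ x, |V x| ≤ Y * (1 + ‖x‖)

/-- The state at the beginning of the time step and the Brownian increment are independent. -/
lemma indepFun_stateOf_increment {d : ℕ} (M : ForwardModel) (μ σ a b : ℝ) (t s : ℝ≥0) :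
    IndepFun (fun w => stateOf (d := d) M μ σ t (simulateNoise a b t s w))
      (fun w => (WithLp.toLp 2 fun k => simulateNoise a b t s w (2, k) : State d))
      (stdNormal d) := by
  classical
  have hi : iIndepFun (fun (l : Fin 3 × Fin d) (w : Fin 3 × Fin d → ℝ) => w l) (stdNormal d) :=
    iIndepFun_pi (X := fun _ x => x) fun _ => aemeasurable_id
  set S : Finset (Fin 3 × Fin d) := Finset.univ.filter fun l => l.1 ≠ 2
  set S' : Finset (Fin 3 × Fin d) := Finset.univ.filter fun l => l.1 = 2
  have hSS : Disjoint S S' := by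
    rw [Finset.disjoint_left]
    intro l hl hl'
    exact (Finset.mem_filter.1 hl).2 (Finset.mem_filter.1 hl').2
  have h := hi.indepFun_finset S S' hSS fun l => measurable_pi_apply l
  -- A partial noise vector is extended by zeros, so that the state and the increment become
  -- functions of disjoint blocks. Neither reads an entry outside its own block.
  set ext : (A : Finset (Fin 3 × Fin d)) → (A → ℝ) → Fin 3 × Fin d → ℝ :=
    fun A u l => if h : l ∈ A then u ⟨l, h⟩ else 0 with hext
  have hextm : ∀ A, Measurable (ext A) := fun A => measurable_pi_lambda _ fun l => by
    by_cases h : l ∈ A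
    · simp only [hext, h, dite_true]
      exact measurable_pi_apply _
    · simp only [hext, h, dite_false]
      exact measurable_const
  have m1 : Measurable fun u => stateOf (d := d) M μ σ t (simulateNoise a b t s (ext S u)) :=
    (measurable_stateOf M μ σ t).comp ((measurable_simulateNoise a b t s).comp (hextm S))
  have m2 : Measurable fun u => (WithLp.toLp 2 fun k =>
      simulateNoise a b t s (ext S' u) (2, k) : State d) :=
    (WithLp.measurable_toLp 2 _).comp (measurable_pi_lambda _ fun k =>
      (measurable_pi_apply (2, k)).comp ((measurable_simulateNoise a b t s).comp (hextm S')))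
  have h3 := h.comp m1 m2
  refine (h3.congr (.of_forall fun w => ?_) (.of_forall fun w => ?_))
  · simp only [Function.comp_apply, stateOf, simulateNoise]
    congr 1 <;> ext k <;> simp [hext, S]
  · simp only [Function.comp_apply, simulateNoise]
    congr 1
    ext k
    simp [hext, S']

namespace StepBound

variable {d : ℕ} {M : ForwardModel} {μ σ a b β : ℝ} {f : ℝ → State d → ℝ → State d → ℝ}
  {t s : ℝ≥0} {V : State d → ℝ} {Y : ℝ}

/-- Allows the approximation error to be estimated with a `Y` that ignores the network size, and the
statistical error with a larger one. -/
lemma mono (h : StepBound M μ σ a b β f t s V Y) {Y' : ℝ} (hY : Y ≤ Y') :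
    StepBound M μ σ a b β f t s V Y' := by
  have he : ∀ w : Fin 3 × Fin d → ℝ, 0 ≤ noiseEnvelope β w := fun w =>
    zero_le_one.trans (one_le_noiseEnvelope h.dim_pos h.exponent_nonneg w)
  exact
  { two_le := h.two_le.trans hY
    dim_pos := h.dim_pos
    dim_le := h.dim_le.trans hY
    time_le := h.time_le
    step_le := h.step_le.trans hY
    exponent_nonneg := h.exponent_nonneg
    state_le := fun w => (h.state_le w).trans (mul_le_mul_of_nonneg_right hY (he w))
    next_le := fun w => (h.next_le w).trans (mul_le_mul_of_nonneg_right hY (he w))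
    increment_le := fun w => (h.increment_le w).trans (mul_le_mul_of_nonneg_right hY (he w))
    moment_le := h.moment_le.trans hY
    measurable_driver := h.measurable_driver
    measurable_next := h.measurable_next
    driver_le := fun x y z => (h.driver_le x y z).trans (by gcongr)
    driver_sub_le := fun x y y' z z' => (h.driver_sub_le x y y' z z').trans (by gcongr)
    next_value_le := fun x => (h.next_value_le x).trans (by gcongr) }

lemma one_le_envelope (h : StepBound M μ σ a b β f t s V Y) (w : Fin 3 × Fin d → ℝ) :
    1 ≤ noiseEnvelope β w := one_le_noiseEnvelope h.dim_pos h.exponent_nonneg w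

lemma one_le (h : StepBound M μ σ a b β f t s V Y) : 1 ≤ Y := one_le_two.trans h.two_le

lemma abs_residual_le (h : StepBound M μ σ a b β f t s V Y) {U : State d → ℝ}
    {Z : State d → State d} (hU : ∀ x, |U x| ≤ Y * (1 + ‖x‖)) (hZ : ∀ x, ‖Z x‖ ≤ Y * (1 + ‖x‖))
    (w : Fin 3 × Fin d → ℝ) :
    |residual M μ σ f t s V U Z (simulateNoise a b t s w)| ≤
      12 * Y ^ 4 * noiseEnvelope β w ^ 2 :=
  DBDP.abs_residual_le h.one_le (h.one_le_envelope w) h.time_le h.step_le h.next_value_le hU hZ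
    h.driver_le (h.state_le w) (h.next_le w) (h.increment_le w)

lemma integrable_envelope_pow (h : StepBound M μ σ a b β f t s V Y) {n : ℕ} (hn : n ≤ 8) :
    Integrable (fun w => noiseEnvelope β w ^ n) (stdNormal d) := by
  refine (noiseEnvelope_moment β h.exponent_nonneg).1.mono'
    ((measurable_noiseEnvelope β).pow_const n).aestronglyMeasurable (.of_forall fun w => ?_)
  have h1 := h.one_le_envelope w
  rw [Real.norm_eq_abs, abs_of_nonneg (by positivity)]
  exact pow_le_pow_right₀ h1 hn

lemma integral_envelope_pow_le (h : StepBound M μ σ a b β f t s V Y) {n : ℕ} (hn : n ≤ 8) :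
    ∫ w, noiseEnvelope β w ^ n ∂stdNormal d ≤ Y :=
  (integral_mono (h.integrable_envelope_pow hn) (h.integrable_envelope_pow le_rfl)
    fun w => pow_le_pow_right₀ (h.one_le_envelope w) hn).trans h.moment_le

lemma memLp_of_le (h : StepBound M μ σ a b β f t s V Y) {E : Type*} [NormedAddCommGroup E]
    {F : State d → E} (hF : AEStronglyMeasurable
      (fun w => F (stateOf M μ σ t (simulateNoise a b t s w))) (stdNormal d))
    {C : ℝ} (hC : 0 ≤ C) (hle : ∀ x, ‖F x‖ ≤ C * (1 + ‖x‖)) :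
    MemLp (fun w => F (stateOf M μ σ t (simulateNoise a b t s w))) 2 (stdNormal d) := by
  have he : MemLp (fun w => noiseEnvelope β w) 2 (stdNormal d) :=
    (memLp_two_iff_integrable_sq (measurable_noiseEnvelope β).aestronglyMeasurable).2
      (h.integrable_envelope_pow (by norm_num))
  refine he.of_le_mul (c := C * (1 + Y)) hF (.of_forall fun w => ?_)
  have h1 := h.one_le_envelope w
  rw [Real.norm_eq_abs, abs_of_nonneg (zero_le_one.trans h1), mul_assoc]
  refine (hle _).trans ?_
  gcongr
  linarith [h.state_le w]

/-- The mean square difference of the residuals of two pairs of functions. -/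
lemma integral_sq_residual_sub_le (h : StepBound M μ σ a b β f t s V Y) {U U' : State d → ℝ}
    {Z Z' : State d → State d} (hU : Measurable U) (hU' : Measurable U') (hZ : Measurable Z)
    (hZ' : Measurable Z')
    (hUi : Integrable (fun w => (U (stateOf M μ σ t (simulateNoise a b t s w)) -
      U' (stateOf M μ σ t (simulateNoise a b t s w))) ^ 2) (stdNormal d))
    (hZi : Integrable (fun w => ‖Z (stateOf M μ σ t (simulateNoise a b t s w)) -
      Z' (stateOf M μ σ t (simulateNoise a b t s w))‖ ^ 2) (stdNormal d)) {ε : ℝ}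
    (hε : ∫ w, (U (stateOf M μ σ t (simulateNoise a b t s w)) -
        U' (stateOf M μ σ t (simulateNoise a b t s w))) ^ 2 ∂stdNormal d +
      ∫ w, ‖Z (stateOf M μ σ t (simulateNoise a b t s w)) -
        Z' (stateOf M μ σ t (simulateNoise a b t s w))‖ ^ 2 ∂stdNormal d ≤ ε) :
    Integrable (fun w => (residual M μ σ f t s V U Z (simulateNoise a b t s w) -
      residual M μ σ f t s V U' Z' (simulateNoise a b t s w)) ^ 2) (stdNormal d) ∧
    ∫ w, (residual M μ σ f t s V U Z (simulateNoise a b t s w) -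
      residual M μ σ f t s V U' Z' (simulateNoise a b t s w)) ^ 2 ∂stdNormal d ≤
        16 * Y ^ 4 * ε := by
  set x : (Fin 3 × Fin d → ℝ) → State d := fun w => stateOf M μ σ t (simulateNoise a b t s w)
    with hx
  set Δ : (Fin 3 × Fin d → ℝ) → State d :=
    fun w => WithLp.toLp 2 fun k => simulateNoise a b t s w (2, k) with hΔ
  set D : (Fin 3 × Fin d → ℝ) → ℝ := fun w =>
    residual M μ σ f t s V U Z (simulateNoise a b t s w) -
      residual M μ σ f t s V U' Z' (simulateNoise a b t s w) with hD
  have hsim := measurable_simulateNoise (d := d) a b t s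
  have hDm : Measurable D :=
    ((measurable_residual M μ σ h.measurable_driver h.measurable_next hU hZ).comp hsim).sub
      ((measurable_residual M μ σ h.measurable_driver h.measurable_next hU' hZ').comp hsim)
  have hΔm : Measurable Δ := (WithLp.measurable_toLp 2 _).comp
    (measurable_pi_lambda _ fun k => (measurable_pi_apply (2, k)).comp hsim)
  have hY := h.one_le
  have hΔle : ∀ w, ‖Δ w‖ ^ 2 ≤ Y ^ 2 * noiseEnvelope β w ^ 2 := fun w => by
    rw [← mul_pow]
    exact pow_le_pow_left₀ (norm_nonneg _) (h.increment_le w) 2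
  have hΔi : Integrable (fun w => ‖Δ w‖ ^ 2) (stdNormal d) := by
    refine ((h.integrable_envelope_pow (n := 2) (by norm_num)).const_mul (Y ^ 2)).mono'
      (hΔm.norm.pow_const 2).aestronglyMeasurable (.of_forall fun w => ?_)
    rw [Real.norm_eq_abs, abs_of_nonneg (by positivity)]
    exact hΔle w
  have hΔI : ∫ w, ‖Δ w‖ ^ 2 ∂stdNormal d ≤ Y ^ 3 := by
    calc ∫ w, ‖Δ w‖ ^ 2 ∂stdNormal d
        ≤ ∫ w, Y ^ 2 * noiseEnvelope β w ^ 2 ∂stdNormal d :=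
          integral_mono hΔi ((h.integrable_envelope_pow (by norm_num)).const_mul _) hΔle
      _ ≤ Y ^ 2 * Y := by
          rw [integral_const_mul]
          gcongr
          exact h.integral_envelope_pow_le (by norm_num)
      _ = Y ^ 3 := by ring
  -- Z - Z' is only square integrable, so its product with the increment is controlled in L² through
  -- independence.
  have hind : IndepFun (fun w => ‖Z (x w) - Z' (x w)‖ ^ 2) (fun w => ‖Δ w‖ ^ 2) (stdNormal d) :=
    (indepFun_stateOf_increment M μ σ a b t s).comp
      (φ := fun x => ‖Z x - Z' x‖ ^ 2) (ψ := fun z => ‖z‖ ^ 2)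
      ((hZ.sub hZ').norm.pow_const 2) (measurable_norm.pow_const 2)
  have hZΔi : Integrable (fun w => ‖Z (x w) - Z' (x w)‖ ^ 2 * ‖Δ w‖ ^ 2) (stdNormal d) :=
    hind.integrable_mul hZi hΔi
  have hZΔI : ∫ w, ‖Z (x w) - Z' (x w)‖ ^ 2 * ‖Δ w‖ ^ 2 ∂stdNormal d =
      (∫ w, ‖Z (x w) - Z' (x w)‖ ^ 2 ∂stdNormal d) * ∫ w, ‖Δ w‖ ^ 2 ∂stdNormal d :=
    hind.integral_fun_mul_eq_mul_integral hZi.aestronglyMeasurable hΔi.aestronglyMeasurable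
  -- The coefficients come from (p + q)² ≤ 2p² + 2q², applied to the U and Z parts and then to the
  -- factor Y² + ‖Δ‖ of the Z part.
  set F : (Fin 3 × Fin d → ℝ) → ℝ := fun w =>
    2 * (1 + Y ^ 2) ^ 2 * (U (x w) - U' (x w)) ^ 2 +
      (4 * Y ^ 4 * ‖Z (x w) - Z' (x w)‖ ^ 2 + 4 * (‖Z (x w) - Z' (x w)‖ ^ 2 * ‖Δ w‖ ^ 2)) with hF
  have hFi : Integrable F (stdNormal d) :=
    (hUi.const_mul _).add ((hZi.const_mul _).add (hZΔi.const_mul _))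
  have hDF : ∀ w, D w ^ 2 ≤ F w := fun w => by
    have h1 := abs_residual_sub_le (M := M) (μ := μ) (σ := σ) (V := V) (U := U) (U' := U')
      (Z := Z) (Z' := Z') (y := simulateNoise a b t s w) (zero_le_one.trans hY) h.time_le
      h.step_le h.driver_sub_le
    have h1' : |D w| ≤ (1 + Y ^ 2) * |U (x w) - U' (x w)| +
        (Y ^ 2 + ‖Δ w‖) * ‖Z (x w) - Z' (x w)‖ := h1
    have h2 : D w ^ 2 ≤ ((1 + Y ^ 2) * |U (x w) - U' (x w)| +
        (Y ^ 2 + ‖Δ w‖) * ‖Z (x w) - Z' (x w)‖) ^ 2 := by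
      rw [← sq_abs (D w)]
      exact pow_le_pow_left₀ (abs_nonneg _) h1' 2
    refine h2.trans ?_
    set u := |U (x w) - U' (x w)|
    set z := ‖Z (x w) - Z' (x w)‖
    set n := ‖Δ w‖
    have h3 : ((1 + Y ^ 2) * u + (Y ^ 2 + n) * z) ^ 2 ≤
        2 * ((1 + Y ^ 2) * u) ^ 2 + 2 * ((Y ^ 2 + n) * z) ^ 2 := by
      nlinarith [sq_nonneg ((1 + Y ^ 2) * u - (Y ^ 2 + n) * z)]
    have h4 : ((Y ^ 2 + n) * z) ^ 2 ≤ 2 * (Y ^ 2 * z) ^ 2 + 2 * (n * z) ^ 2 := by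
      nlinarith [sq_nonneg (Y ^ 2 * z - n * z)]
    have h5 : u ^ 2 = (U (x w) - U' (x w)) ^ 2 := sq_abs _
    simp only [hF]
    rw [← h5]
    nlinarith
  have hDi : Integrable (fun w => D w ^ 2) (stdNormal d) :=
    hFi.mono' (hDm.pow_const 2).aestronglyMeasurable (.of_forall fun w => by
      rw [Real.norm_eq_abs, abs_of_nonneg (sq_nonneg _)]
      exact hDF w)
  refine ⟨hDi, (integral_mono hDi hFi hDF).trans ?_⟩
  have hIu : 0 ≤ ∫ w, (U (x w) - U' (x w)) ^ 2 ∂stdNormal d :=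
    integral_nonneg fun w => sq_nonneg _
  have hIz : 0 ≤ ∫ w, ‖Z (x w) - Z' (x w)‖ ^ 2 ∂stdNormal d :=
    integral_nonneg fun w => sq_nonneg _
  have hFI : ∫ w, F w ∂stdNormal d =
      2 * (1 + Y ^ 2) ^ 2 * ∫ w, (U (x w) - U' (x w)) ^ 2 ∂stdNormal d +
      (4 * Y ^ 4 * ∫ w, ‖Z (x w) - Z' (x w)‖ ^ 2 ∂stdNormal d +
        4 * ((∫ w, ‖Z (x w) - Z' (x w)‖ ^ 2 ∂stdNormal d) * ∫ w, ‖Δ w‖ ^ 2 ∂stdNormal d)) := by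
    rw [← hZΔI, ← integral_const_mul, ← integral_const_mul, ← integral_const_mul]
    have i1 : Integrable (fun w => 2 * (1 + Y ^ 2) ^ 2 * (U (x w) - U' (x w)) ^ 2)
      (stdNormal d) := hUi.const_mul _
    have i2 : Integrable (fun w => 4 * Y ^ 4 * ‖Z (x w) - Z' (x w)‖ ^ 2) (stdNormal d) :=
      hZi.const_mul _
    have i3 : Integrable (fun w => 4 * (‖Z (x w) - Z' (x w)‖ ^ 2 * ‖Δ w‖ ^ 2)) (stdNormal d) :=
      hZΔi.const_mul _
    exact (integral_add i1 (i2.add i3)).trans (congrArg _ (integral_add i2 i3))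
  rw [hFI]
  set u := ∫ w, (U (x w) - U' (x w)) ^ 2 ∂stdNormal d
  set z := ∫ w, ‖Z (x w) - Z' (x w)‖ ^ 2 ∂stdNormal d
  set n := ∫ w, ‖Δ w‖ ^ 2 ∂stdNormal d
  have c1 : 2 * (1 + Y ^ 2) ^ 2 ≤ 16 * Y ^ 4 := by
    have : 1 ≤ Y ^ 2 := one_le_pow₀ hY
    nlinarith
  have c2 : n ≤ Y ^ 4 := hΔI.trans (pow_le_pow_right₀ hY (by norm_num))
  calc 2 * (1 + Y ^ 2) ^ 2 * u + (4 * Y ^ 4 * z + 4 * (z * n))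
      ≤ 16 * Y ^ 4 * u + (4 * Y ^ 4 * z + 4 * (z * Y ^ 4)) := by gcongr
    _ ≤ 16 * Y ^ 4 * (u + z) := by
        have : 0 ≤ Y ^ 4 * z := by positivity
        nlinarith
    _ ≤ 16 * Y ^ 4 * ε := by gcongr

/-- A pair that approximates one with smaller risk than `(0, 0)` is almost as good. -/
lemma integral_sq_residual_le_add (h : StepBound M μ σ a b β f t s V Y) {U U' : State d → ℝ}
    {Z Z' : State d → State d} (hU : Measurable U) (hU' : Measurable U') (hZ : Measurable Z)
    (hZ' : Measurable Z')
    (hUi : Integrable (fun w => (U (stateOf M μ σ t (simulateNoise a b t s w)) -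
      U' (stateOf M μ σ t (simulateNoise a b t s w))) ^ 2) (stdNormal d))
    (hZi : Integrable (fun w => ‖Z (stateOf M μ σ t (simulateNoise a b t s w)) -
      Z' (stateOf M μ σ t (simulateNoise a b t s w))‖ ^ 2) (stdNormal d)) {ε : ℝ}
    (hε : ∫ w, (U (stateOf M μ σ t (simulateNoise a b t s w)) -
        U' (stateOf M μ σ t (simulateNoise a b t s w))) ^ 2 ∂stdNormal d +
      ∫ w, ‖Z (stateOf M μ σ t (simulateNoise a b t s w)) -
        Z' (stateOf M μ σ t (simulateNoise a b t s w))‖ ^ 2 ∂stdNormal d ≤ ε)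
    (hεY : ε ≤ (Y ^ 32)⁻¹)
    (hi' : Integrable (fun w => residual M μ σ f t s V U' Z' (simulateNoise a b t s w) ^ 2)
      (stdNormal d))
    (hopt : ∫ w, residual M μ σ f t s V U Z (simulateNoise a b t s w) ^ 2 ∂stdNormal d ≤
      ∫ w, residual M μ σ f t s V (fun _ => 0) (fun _ => 0) (simulateNoise a b t s w) ^ 2
        ∂stdNormal d) :
    ∫ w, residual M μ σ f t s V U' Z' (simulateNoise a b t s w) ^ 2 ∂stdNormal d ≤
      ∫ w, residual M μ σ f t s V U Z (simulateNoise a b t s w) ^ 2 ∂stdNormal d + 1 / (2 * Y) := by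
  obtain ⟨hDi, hDI⟩ := h.integral_sq_residual_sub_le hU hU' hZ hZ' hUi hZi hε
  have hY := h.one_le
  have hY0 : 0 < Y := zero_lt_one.trans_le hY
  set H : (Fin 3 × Fin d → ℝ) → ℝ := fun w =>
    residual M μ σ f t s V U Z (simulateNoise a b t s w) with hH
  set H' : (Fin 3 × Fin d → ℝ) → ℝ := fun w =>
    residual M μ σ f t s V U' Z' (simulateNoise a b t s w) with hH'
  have hHm : Measurable H :=
    (measurable_residual M μ σ h.measurable_driver h.measurable_next hU hZ).comp
      (measurable_simulateNoise a b t s)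
  have hi : Integrable (fun w => H w ^ 2) (stdNormal d) := by
    refine ((hi'.const_mul 2).add (hDi.const_mul 2)).mono' (hHm.pow_const 2).aestronglyMeasurable
      (.of_forall fun w => ?_)
    rw [Real.norm_eq_abs, abs_of_nonneg (sq_nonneg _)]
    simp only [Pi.add_apply]
    change H w ^ 2 ≤ 2 * H' w ^ 2 + 2 * (H w - H' w) ^ 2
    nlinarith [sq_nonneg (H w - 2 * H' w)]
  -- Optimality enters only here: the risk is at most that of (0, 0), whose residual is below 12 Y⁴
  -- e², and the moment of e⁴ costs one more `Y`.
  have hL : ∫ w, H w ^ 2 ∂stdNormal d ≤ 144 * Y ^ 9 := by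
    refine hopt.trans ?_
    have hle : ∀ w : Fin 3 × Fin d → ℝ,
        residual M μ σ f t s V (fun _ => 0) (fun _ => 0) (simulateNoise a b t s w) ^ 2 ≤
          144 * Y ^ 8 * noiseEnvelope β w ^ 4 := fun w => by
      have h1 := h.abs_residual_le (U := fun _ => 0) (Z := fun _ => 0)
        (fun x => by rw [abs_zero]; positivity) (fun x => by rw [norm_zero]; positivity) w
      rw [← sq_abs]
      calc _ ≤ (12 * Y ^ 4 * noiseEnvelope β w ^ 2) ^ 2 := pow_le_pow_left₀ (abs_nonneg _) h1 2
        _ = _ := by ring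
    calc _ ≤ ∫ w, 144 * Y ^ 8 * noiseEnvelope β w ^ 4 ∂stdNormal d :=
          integral_mono_of_nonneg (.of_forall fun w => sq_nonneg _)
            ((h.integrable_envelope_pow (by norm_num)).const_mul _) (.of_forall hle)
      _ ≤ 144 * Y ^ 8 * Y := by
          rw [integral_const_mul]
          gcongr
          exact h.integral_envelope_pow_le (by norm_num)
      _ = _ := by ring
  -- The weight in Young's inequality, chosen so that 144 Y⁹ / τ = 1 / (4Y). The other term becomes
  -- 18432 / Y¹⁸ once ε ≤ Y⁻³², which is again at most 1 / (4Y) because Y¹⁷ ≥ 2¹⁷.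
  set τ : ℝ := 576 * Y ^ 10 with hτ
  have hτ0 : 0 < τ := by positivity
  have hτ1 : 1 ≤ τ := by
    have : 1 ≤ Y ^ 10 := one_le_pow₀ hY
    linarith
  have hpt : ∀ w, H' w ^ 2 ≤ (1 + 1 / τ) * H w ^ 2 + (1 + τ) * (H w - H' w) ^ 2 := fun w => by
    have e : (1 + 1 / τ) * H w ^ 2 + (1 + τ) * (H w - H' w) ^ 2 - H' w ^ 2 =
        (H w + τ * (H w - H' w)) ^ 2 / τ := by
      field_simp
      ring
    have : 0 ≤ (H w + τ * (H w - H' w)) ^ 2 / τ := by positivity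
    linarith
  calc ∫ w, H' w ^ 2 ∂stdNormal d
      ≤ ∫ w, ((1 + 1 / τ) * H w ^ 2 + (1 + τ) * (H w - H' w) ^ 2) ∂stdNormal d :=
        integral_mono hi' ((hi.const_mul _).add (hDi.const_mul _)) hpt
    _ = (1 + 1 / τ) * ∫ w, H w ^ 2 ∂stdNormal d +
          (1 + τ) * ∫ w, (H w - H' w) ^ 2 ∂stdNormal d := by
        rw [integral_add (hi.const_mul _) (hDi.const_mul _), integral_const_mul,
          integral_const_mul]
    _ ≤ ∫ w, H w ^ 2 ∂stdNormal d + 1 / τ * (144 * Y ^ 9) +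
          2 * τ * (16 * Y ^ 4 * (Y ^ 32)⁻¹) := by
        have h1 : 1 / τ * ∫ w, H w ^ 2 ∂stdNormal d ≤ 1 / τ * (144 * Y ^ 9) := by gcongr
        have h2 : (1 + τ) * ∫ w, (H w - H' w) ^ 2 ∂stdNormal d ≤
            2 * τ * (16 * Y ^ 4 * (Y ^ 32)⁻¹) := by
          have h3 : ∫ w, (H w - H' w) ^ 2 ∂stdNormal d ≤ 16 * Y ^ 4 * (Y ^ 32)⁻¹ :=
            hDI.trans (by gcongr)
          exact mul_le_mul (by linarith) h3 (integral_nonneg fun w => sq_nonneg _) (by positivity)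
        rw [add_mul, one_mul]
        linarith
    _ ≤ _ := by
        have e1 : 1 / τ * (144 * Y ^ 9) = 1 / (4 * Y) := by
          rw [hτ]
          field_simp
          norm_num
        have e2 : 2 * τ * (16 * Y ^ 4 * (Y ^ 32)⁻¹) ≤ 1 / (4 * Y) := by
          have e3 : 2 * τ * (16 * Y ^ 4 * (Y ^ 32)⁻¹) = 18432 / Y ^ 18 := by
            rw [hτ]
            field_simp
            norm_num
          rw [e3, div_le_div_iff₀ (by positivity) (by positivity)]
          have : (2 : ℝ) ^ 17 ≤ Y ^ 17 := pow_le_pow_left₀ (by norm_num) h.two_le 17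
          calc 18432 * (4 * Y) ≤ (2 : ℝ) ^ 17 * Y := by nlinarith
            _ ≤ Y ^ 17 * Y := by gcongr
            _ = 1 * Y ^ 18 := by ring
        have e4 : 1 / (2 * Y) = 1 / (4 * Y) + 1 / (4 * Y) := by
          field_simp
          norm_num
        rw [e1, e4]
        linarith

end StepBound

/-! ### The statistical error -/

/-- Polynomially many samples suffice for a class with exponentially large covering number. -/
lemma deviation_bound_le {Y ρ m J A K δ : ℝ} (hY : 2 ≤ Y) (hρ : 0 < ρ)
    (hA : A = 20736 * Y ^ 17) (hK : K ^ 2 = 8 * A * Y) (hδ : δ = 1 / (16 * Y))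
    (hJ : J ≤ Real.exp (Y ^ 50)) (hm : Y ^ 132 * (1 + ρ⁻¹) ≤ m) :
    J * Real.exp (-(2 * m * δ ^ 2 / K ^ 4)) + A / (m * δ ^ 2) ≤ ρ := by
  have hY0 : 0 < Y := by linarith
  have hY1 : 1 ≤ Y := by linarith
  have hρ' : 0 < ρ⁻¹ := inv_pos.2 hρ
  have hm0 : 0 < m := lt_of_lt_of_le (by positivity) hm
  -- 3522410053632 = 8192 · 20736².
  have e1 : 2 * m * δ ^ 2 / K ^ 4 = m / (3522410053632 * Y ^ 38) := by
    have : K ^ 4 = (8 * A * Y) ^ 2 := by rw [← hK]; ring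
    rw [this, hA, hδ]
    field_simp
    norm_num
  have b1 : 3522410053632 * Y ^ 38 ≤ Y ^ 80 := by
    calc 3522410053632 * Y ^ 38 ≤ (2 : ℝ) ^ 42 * Y ^ 38 := by gcongr; norm_num
      _ ≤ Y ^ 42 * Y ^ 38 := by gcongr
      _ = Y ^ 80 := by ring
  -- Y⁵⁰ cancels the logarithm of the cover size, and the remaining exp(-2/ρ) is at most ρ/2.
  have b2 : Y ^ 50 + 2 * ρ⁻¹ ≤ m / (3522410053632 * Y ^ 38) := by
    rw [le_div_iff₀ (by positivity)]
    calc (Y ^ 50 + 2 * ρ⁻¹) * (3522410053632 * Y ^ 38) ≤ (Y ^ 52 * (1 + ρ⁻¹)) * Y ^ 80 := by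
          gcongr
          have h1 : Y ^ 50 ≤ Y ^ 52 := pow_le_pow_right₀ hY1 (by norm_num)
          have h2 : (2 : ℝ) ≤ Y ^ 52 := hY.trans (le_self_pow₀ hY1 (by norm_num))
          nlinarith
      _ = Y ^ 132 * (1 + ρ⁻¹) := by ring
      _ ≤ m := hm
  have t1 : J * Real.exp (-(2 * m * δ ^ 2 / K ^ 4)) ≤ ρ / 2 := by
    rw [e1]
    calc J * Real.exp (-(m / (3522410053632 * Y ^ 38)))
        ≤ Real.exp (Y ^ 50) * Real.exp (-(Y ^ 50 + 2 * ρ⁻¹)) := by gcongr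
      _ = (Real.exp (2 * ρ⁻¹))⁻¹ := by rw [← Real.exp_add, ← Real.exp_neg]; congr 1; ring
      _ ≤ (2 * ρ⁻¹)⁻¹ := by
          gcongr
          linarith [Real.add_one_le_exp (2 * ρ⁻¹)]
      _ = ρ / 2 := by rw [mul_inv, inv_inv]; ring
  have t2 : A / (m * δ ^ 2) ≤ ρ / 2 := by
    have e2 : A / (m * δ ^ 2) = 5308416 * Y ^ 19 / m := by
      rw [hA, hδ]
      field_simp
      norm_num
    rw [e2, div_le_iff₀ hm0]
    have h1 : 5308416 * Y ^ 19 * 2 ≤ Y ^ 132 := by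
      calc 5308416 * Y ^ 19 * 2 ≤ (2 : ℝ) ^ 24 * Y ^ 19 := by
            have : 0 < Y ^ 19 := by positivity
            norm_num
            linarith
        _ ≤ Y ^ 24 * Y ^ 19 := by gcongr
        _ = Y ^ 43 := by ring
        _ ≤ Y ^ 132 := pow_le_pow_right₀ hY1 (by norm_num)
    have h2 : Y ^ 132 ≤ ρ * m := by
      have h3 : Y ^ 132 * ρ⁻¹ ≤ m := le_trans (by nlinarith [pow_pos hY0 132]) hm
      calc Y ^ 132 = ρ * (Y ^ 132 * ρ⁻¹) := by field_simp
        _ ≤ ρ * m := by gcongr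
    linarith
  linarith

/-- The size of the cover of the parameter set. -/
lemma cover_card_le {Y R κ w : ℝ} {D n N : ℕ} (hY : 2 ≤ Y) (hR0 : 0 ≤ R) (hR : R ≤ Y)
    (hw0 : 0 ≤ w) (hw : w ≤ Y)
    (hD : (D : ℝ) ≤ Y) (hn : (n : ℝ) ≤ 2 * Y * (Y * Y + Y))
    (hκ : κ = 1 / (256 * (20736 * Y ^ 17) * Y ^ 2))
    (hN : N = ⌊2 * R / (κ / ((w + 1) * (R + 1)) ^ D)⌋₊) :
    ((N : ℝ) + 1) ^ n ≤ Real.exp (Y ^ 50) := by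
  have hY0 : 0 < Y := by linarith
  have hY1 : 1 ≤ Y := by linarith
  set Λ := ((w + 1) * (R + 1)) ^ D with hΛ
  have hΛ1 : 1 ≤ Λ := one_le_pow₀ (by nlinarith)
  have hexp : ∀ x : ℝ, x ≤ Real.exp x := fun x => by linarith [Real.add_one_le_exp x]
  -- Although Λ is exponential in the depth, its logarithm is polynomial in `Y`.
  have hΛe : Λ ≤ Real.exp (4 * Y ^ 3) := by
    have h1 : (w + 1) * (R + 1) ≤ 4 * Y ^ 2 := by
      calc (w + 1) * (R + 1) ≤ (2 * Y) * (2 * Y) := by gcongr <;> linarith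
        _ = 4 * Y ^ 2 := by ring
    calc Λ ≤ Real.exp (4 * Y ^ 2) ^ D :=
          pow_le_pow_left₀ (by positivity) (h1.trans (hexp _)) D
      _ = Real.exp (D * (4 * Y ^ 2)) := by rw [← Real.exp_nat_mul]
      _ ≤ Real.exp (Y * (4 * Y ^ 2)) := by gcongr
      _ = _ := by congr 1; ring
  have hκ0 : 0 < κ := by rw [hκ]; positivity
  -- 10616832 = 2 · 256 · 20736, and one further unit absorbs the summand 1.
  have h1 : (N : ℝ) + 1 ≤ (10616833 * Y ^ 20) * Λ := by
    have h2 : (N : ℝ) ≤ 2 * R / (κ / Λ) := by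
      rw [hN]
      exact Nat.floor_le (by positivity)
    have h3 : 2 * R / (κ / Λ) = 10616832 * R * Y ^ 19 * Λ := by
      rw [hκ]
      field_simp
      ring
    have h4 : 10616832 * R * Y ^ 19 * Λ ≤ 10616832 * Y * Y ^ 19 * Λ := by gcongr
    have h5 : 1 ≤ Y ^ 20 * Λ := one_le_mul_of_one_le_of_one_le (one_le_pow₀ hY1) hΛ1
    nlinarith
  have h6 : (N : ℝ) + 1 ≤ Real.exp (Y ^ 45) := by
    calc (N : ℝ) + 1 ≤ (10616833 * Y ^ 20) * Λ := h1
      _ ≤ Real.exp (10616833 * Y ^ 20) * Real.exp (4 * Y ^ 3) := by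
          gcongr
          exact hexp _
      _ = Real.exp (10616833 * Y ^ 20 + 4 * Y ^ 3) := by rw [Real.exp_add]
      _ ≤ Real.exp (Y ^ 45) := by
          gcongr
          have h7 : Y ^ 3 ≤ Y ^ 20 := pow_le_pow_right₀ hY1 (by norm_num)
          calc 10616833 * Y ^ 20 + 4 * Y ^ 3 ≤ (2 : ℝ) ^ 25 * Y ^ 20 := by
                have : 0 < Y ^ 20 := by positivity
                norm_num
                linarith
            _ ≤ Y ^ 25 * Y ^ 20 := by gcongr
            _ = Y ^ 45 := by ring
  calc ((N : ℝ) + 1) ^ n ≤ Real.exp (Y ^ 45) ^ n := by gcongr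
    _ = Real.exp (n * Y ^ 45) := by rw [← Real.exp_nat_mul]
    _ ≤ Real.exp (Y ^ 50) := by
        gcongr
        calc (n : ℝ) * Y ^ 45 ≤ (2 * Y * (Y * Y + Y)) * Y ^ 45 := by gcongr
          _ ≤ Y ^ 5 * Y ^ 45 := by
              gcongr
              have h7 : 2 * Y * (Y * Y + Y) ≤ 2 ^ 2 * Y ^ 3 := by nlinarith [sq_nonneg Y]
              have h8 : (2 : ℝ) ^ 2 ≤ Y ^ 2 := pow_le_pow_left₀ (by norm_num) hY 2
              calc _ ≤ 2 ^ 2 * Y ^ 3 := h7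
                _ ≤ Y ^ 2 * Y ^ 3 := by gcongr
                _ = Y ^ 5 := by ring
          _ = Y ^ 50 := by ring

namespace StepBound

variable {d : ℕ} {M : ForwardModel} {μ σ a b β : ℝ} {f : ℝ → State d → ℝ → State d → ℝ}
  {t s : ℝ≥0} {V : State d → ℝ} {Y : ℝ}

lemma measurable_residual_simulate (h : StepBound M μ σ a b β f t s V Y) {U : State d → ℝ}
    (hU : Measurable U) {Z : State d → State d} (hZ : Measurable Z) :
    Measurable fun w => residual M μ σ f t s V U Z (simulateNoise a b t s w) :=
  (measurable_residual M μ σ h.measurable_driver h.measurable_next hU hZ).comp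
    (measurable_simulateNoise a b t s)

lemma netU_growth {hs : List ℕ} {R : ℝ} (hd : 0 < d)
    (hg : d * (R * ((netWidth d hs 1 : ℝ) + 1)) ≤ Y)
    {θ : ParamIdx d hs 1 → ℝ} (hθ : ‖θ‖ ≤ R) (x : State d) : |netU θ x| ≤ Y * (1 + ‖x‖) := by
  refine (abs_netU_le le_rfl hθ x).trans ?_
  have hR := (norm_nonneg _).trans hθ
  have hd' : (1 : ℝ) ≤ d := Nat.one_le_cast.2 hd
  gcongr
  refine le_trans ?_ hg
  exact le_mul_of_one_le_left (by positivity) hd'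

lemma netZ_growth {hs : List ℕ} {R : ℝ} (hg : d * (R * ((netWidth d hs 1 : ℝ) + 1)) ≤ Y)
    {θ : ParamIdx d hs d → ℝ} (hθ : ‖θ‖ ≤ R) (x : State d) : ‖netZ θ x‖ ≤ Y * (1 + ‖x‖) :=
  (norm_netZ_le le_rfl hθ x).trans (by gcongr)

/-- The resolution κ / Λ cancels the Lipschitz constant Λ of the networks in their parameters. The
terms add up to 8 Y⁴ e²; the constant 12 matches the envelope in `abs_residual_le`, as the covering
argument requires. -/
lemma abs_residual_net_sub_le (h : StepBound M μ σ a b β f t s V Y) {hs : List ℕ} {R κ : ℝ}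
    {θ θ' : NetParams d hs} (hθ : ‖θ‖ ≤ R)
    (hθθ : ‖θ - θ'‖ ≤ κ / (((netWidth d hs 1 : ℝ) + 1) * (R + 1)) ^ netDepth hs)
    (w : Fin 3 × Fin d → ℝ) :
    |residual M μ σ f t s V (netU θ.1) (netZ θ.2) (simulateNoise a b t s w) -
      residual M μ σ f t s V (netU θ'.1) (netZ θ'.2) (simulateNoise a b t s w)| ≤
      κ * (12 * Y ^ 4 * noiseEnvelope β w ^ 2) := by
  set Λ := (((netWidth d hs 1 : ℝ) + 1) * (R + 1)) ^ netDepth hs with hΛ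
  have hR : 0 ≤ R := (norm_nonneg _).trans hθ
  have hΛ0 : 0 < Λ := by positivity
  have hκ : 0 ≤ κ := by
    have := (norm_nonneg _).trans hθθ
    rw [le_div_iff₀ hΛ0] at this
    simpa using this
  have hY := h.one_le
  set x := stateOf M μ σ t (simulateNoise a b t s w) with hx
  set e := noiseEnvelope β w
  have he : 1 ≤ e := h.one_le_envelope w
  have hYe : 1 ≤ Y * e := one_le_mul_of_one_le_of_one_le hY he
  have hx1 : 1 + ‖x‖ ≤ 2 * (Y * e) := by
    have := h.state_le w
    linarith
  have u : |netU θ.1 x - netU θ'.1 x| ≤ κ * (2 * (Y * e)) := by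
    refine (abs_netU_sub_le le_rfl ((norm_fst_le θ).trans hθ)
      ((norm_fst_le (θ - θ')).trans hθθ) x).trans ?_
    rw [← hΛ, mul_div_cancel₀ _ hΛ0.ne']
    gcongr
  have z : ‖netZ θ.2 x - netZ θ'.2 x‖ ≤ Y * κ * (2 * (Y * e)) := by
    refine (norm_netZ_sub_le le_rfl ((norm_snd_le θ).trans hθ)
      ((norm_snd_le (θ - θ')).trans hθθ) x).trans ?_
    rw [← hΛ, mul_assoc (d : ℝ), mul_div_cancel₀ _ hΛ0.ne']
    gcongr
    exact h.dim_le
  refine (abs_residual_sub_le (zero_le_one.trans hY) h.time_le h.step_le h.driver_sub_le).trans ?_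
  have n : ‖(WithLp.toLp 2 fun k => simulateNoise a b t s w (2, k) : State d)‖ ≤ Y * e :=
    h.increment_le w
  calc _ ≤ (1 + Y ^ 2) * (κ * (2 * (Y * e))) + (Y ^ 2 + Y * e) * (Y * κ * (2 * (Y * e))) := by
        gcongr
    _ = κ * (2 * (Y * e) + 2 * (Y ^ 3 * e) + 2 * (Y ^ 4 * e) + 2 * (Y ^ 3 * e ^ 2)) := by ring
    _ ≤ κ * (12 * Y ^ 4 * e ^ 2) := by
        gcongr
        have g1 : Y ^ 1 * e ^ 1 ≤ Y ^ 4 * e ^ 2 := by gcongr <;> norm_num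
        have g2 : Y ^ 3 * e ^ 1 ≤ Y ^ 4 * e ^ 2 := by gcongr <;> norm_num
        have g3 : Y ^ 4 * e ^ 1 ≤ Y ^ 4 * e ^ 2 := by gcongr; norm_num
        have g4 : Y ^ 3 * e ^ 2 ≤ Y ^ 4 * e ^ 2 := by gcongr; norm_num
        have : 0 ≤ Y ^ 4 * e ^ 2 := by positivity
        rw [pow_one] at g1 g2 g3
        rw [pow_one] at g1
        linarith

/-- The empirical risk minimizer over networks of size at most `Y` is almost as good as any such
network, if the sample size is polynomial in `Y`. -/
theorem empirical_minimizer_le (h : StepBound M μ σ a b β f t s V Y) {hs : List ℕ} {R : ℝ}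
    (hR : R ≤ Y) (hw : (netWidth d hs 1 : ℝ) ≤ Y) (hD : (netDepth hs : ℝ) ≤ Y)
    (hg : d * (R * ((netWidth d hs 1 : ℝ) + 1)) ≤ Y)
    {Ω : Type*} [MeasurableSpace Ω] {P : Measure Ω} [IsProbabilityMeasure P]
    {m : ℕ} {w : Fin m → Ω → Fin 3 × Fin d → ℝ} (hind : iIndepFun w P)
    (hlaw : ∀ j, HasLaw (w j) (stdNormal d) P) {θh : Ω → NetParams d hs}
    (hmin : ∀ᵐ ω ∂P, IsEmpiricalMinimizer M μ σ a b f t s V (fun j => w j ω) R (θh ω))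
    {θ₀ : NetParams d hs} (hθ₀ : ‖θ₀‖ ≤ R) {ρ : ℝ} (hρ : 0 < ρ)
    (hm : Y ^ 132 * (1 + ρ⁻¹) ≤ m) :
    1 - ρ ≤ P.real {ω |
      ∫ w, residual M μ σ f t s V (netU (θh ω).1) (netZ (θh ω).2) (simulateNoise a b t s w) ^ 2
        ∂stdNormal d ≤
      ∫ w, residual M μ σ f t s V (netU θ₀.1) (netZ θ₀.2) (simulateNoise a b t s w) ^ 2
        ∂stdNormal d + 1 / (2 * Y)} := by
  classical
  have hY := h.one_le
  have hY0 : 0 < Y := zero_lt_one.trans_le hY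
  have hR0 : 0 ≤ R := (norm_nonneg _).trans hθ₀
  have hm0 : 0 < m := by
    have : (0 : ℝ) < m := lt_of_lt_of_le (by positivity) hm
    exact_mod_cast this
  -- `A` bounds the fourth moment of 12 Y⁴ e²: 12⁴ = 20736, with one factor `Y` for the moment of
  -- e⁸. Then `K`, `κ` and the deviation 1/(16Y) make each of 2δ, 4κK² and A/K² equal to 1/(8Y);
  -- their sum is below 1/(2Y).
  set A : ℝ := 20736 * Y ^ 17 with hA
  set κ : ℝ := 1 / (256 * A * Y ^ 2) with hκ
  set Λ : ℝ := (((netWidth d hs 1 : ℝ) + 1) * (R + 1)) ^ netDepth hs with hΛ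
  set K : ℝ := Real.sqrt (8 * A * Y) with hK
  have hA0 : 0 < A := by positivity
  have hκ0 : 0 < κ := by positivity
  have hΛ0 : 0 < Λ := by positivity
  have hK2 : K ^ 2 = 8 * A * Y := Real.sq_sqrt (by positivity)
  have hK0 : 0 < K := Real.sqrt_pos.2 (by positivity)
  set N := ⌊2 * R / (κ / Λ)⌋₊ with hN
  obtain ⟨c₁, hc₁, hcov₁⟩ := exists_finite_cover_pi (ι := ParamIdx d hs 1) hR0 (div_pos hκ0 hΛ0)
  obtain ⟨c₂, hc₂, hcov₂⟩ := exists_finite_cover_pi (ι := ParamIdx d hs d) hR0 (div_pos hκ0 hΛ0)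
  set E : (Fin 3 × Fin d → ℝ) → ℝ := fun w => 12 * Y ^ 4 * noiseEnvelope β w ^ 2 with hE
  have hE4 : ∀ w, E w ^ 4 = 20736 * Y ^ 16 * noiseEnvelope β w ^ 8 := fun w => by
    simp only [hE]; ring
  have hEi : Integrable (fun w => E w ^ 4) (stdNormal d) := by
    simp_rw [hE4]
    exact (h.integrable_envelope_pow le_rfl).const_mul _
  have hEA : ∫ w, E w ^ 4 ∂stdNormal d ≤ A := by
    simp_rw [hE4]
    rw [integral_const_mul, hA]
    calc _ ≤ 20736 * Y ^ 16 * Y := by gcongr; exact h.moment_le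
      _ = _ := by ring
  have hmain := empirical_minimizer_risk_le (ν := stdNormal d) (P := P)
    (J := (ParamIdx d hs 1 → Fin (N + 1)) × (ParamIdx d hs d → Fin (N + 1)))
    (𝓑 := {θ : NetParams d hs | ‖θ‖ ≤ R})
    (H := fun θ w => residual M μ σ f t s V (netU θ.1) (netZ θ.2) (simulateNoise a b t s w))
    (E := E) (c := fun j => (c₁ j.1, c₂ j.2)) (κ := κ) (θ₀ := θ₀) (θh := θh) (A := A)
    (δ := 1 / (16 * Y)) (K := K)
    (fun θ => h.measurable_residual_simulate (continuous_netU θ.1).measurable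
      (continuous_netZ θ.2).measurable)
    (((measurable_noiseEnvelope β).pow_const 2).const_mul _)
    (fun θ hθ w => h.abs_residual_le
      (netU_growth h.dim_pos hg ((norm_fst_le θ).trans hθ))
      (netZ_growth hg ((norm_snd_le θ).trans hθ)) w)
    hEi hEA (fun j => (norm_prod_le_iff).2 ⟨hc₁ _, hc₂ _⟩) hκ0.le
    (fun θ hθ => by
      obtain ⟨j₁, hj₁⟩ := hcov₁ θ.1 ((norm_fst_le θ).trans hθ)
      obtain ⟨j₂, hj₂⟩ := hcov₂ θ.2 ((norm_snd_le θ).trans hθ)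
      exact ⟨(j₁, j₂), h.abs_residual_net_sub_le hθ (norm_prod_le_iff.2 ⟨hj₁, hj₂⟩)⟩)
    -- By definition `sampleLoss` is the squared residual at the simulated noise, so the minimality
    -- over all parameters is used only against θ₀.
    hm0 hind hlaw hθ₀ (hmin.mono fun ω hω => ⟨hω.1, hω.2 θ₀ hθ₀⟩) (by positivity) hK0
  have hcard : ((Fintype.card ((ParamIdx d hs 1 → Fin (N + 1)) × (ParamIdx d hs d → Fin (N + 1))) :
      ℕ) : ℝ) ≤ Real.exp (Y ^ 50) := by
    rw [Fintype.card_prod, Fintype.card_fun, Fintype.card_fun, Fintype.card_fin, ← pow_add]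
    push_cast
    refine cover_card_le h.two_le hR0 hR (Nat.cast_nonneg _) hw hD ?_ hκ hN
    have n1 := card_paramIdx_le hs (le_refl (netWidth d hs 1))
    have n2 := card_paramIdx_le hs (netWidth_self_le d hs)
    have n3 : ((Fintype.card (ParamIdx d hs 1) + Fintype.card (ParamIdx d hs d) : ℕ) : ℝ) ≤
        2 * (netDepth hs * ((netWidth d hs 1 : ℝ) * netWidth d hs 1 + netWidth d hs 1)) := by
      have := add_le_add n1 n2
      rw [← two_mul] at this
      exact_mod_cast this
    refine n3.trans ?_
    rw [mul_assoc]
    gcongr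
  have hdev := deviation_bound_le h.two_le hρ hA hK2 rfl hcard hm
  refine le_trans (by linarith) (hmain.trans ?_)
  refine measureReal_mono (fun ω hω => ?_)
  refine le_trans (Set.mem_ofPred_eq ▸ hω) ?_
  gcongr
  rw [hK2]
  have e1 : 4 * κ * (8 * A * Y) = 1 / (8 * Y) := by
    rw [hκ]
    field_simp
    norm_num
  have e2 : A / (8 * A * Y) = 1 / (8 * Y) := by field_simp
  have e3 : 2 * (1 / (16 * Y)) = 1 / (8 * Y) := by
    field_simp
    norm_num
  have e4 : 1 / (2 * Y) = 4 * (1 / (8 * Y)) := by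
    field_simp
    norm_num
  have : 0 < 1 / (8 * Y) := by positivity
  rw [e1, e2, e3, e4]
  linarith

end StepBound

/-! ### Polynomial dependence on the parameters -/

/-- Absorbs a fixed constant into a power of any S ≥ 2. -/
lemma exists_le_two_pow (c : ℝ) : ∃ n : ℕ, c ≤ 2 ^ n := by
  obtain ⟨n, hn⟩ := pow_unbounded_of_one_lt c one_lt_two
  exact ⟨n, hn.le⟩

lemma pow_add_pow_le {S : ℝ} (hS : 2 ≤ S) (n m : ℕ) : S ^ n + S ^ m ≤ S ^ (n + m + 1) := by
  have h1 : 1 ≤ S := by linarith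
  have hn : S ^ n ≤ S ^ (n + m) := pow_le_pow_right₀ h1 (by omega)
  have hm : S ^ m ≤ S ^ (n + m) := pow_le_pow_right₀ h1 (by omega)
  have h0 : 0 < S ^ (n + m) := by positivity
  rw [pow_succ]
  nlinarith

/-- A polynomial in bounded arguments is bounded by a power of the bound. -/
lemma exists_abs_eval_le_pow {k : ℕ} (p : MvPolynomial (Fin k) ℝ) :
    ∃ n : ℕ, ∀ (S : ℝ) (x : Fin k → ℝ), 2 ≤ S → (∀ i, |x i| ≤ S) →
      |MvPolynomial.eval x p| ≤ S ^ n := by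
  induction p using MvPolynomial.induction_on with
  | C c =>
    obtain ⟨n, hn⟩ := exists_le_two_pow |c|
    refine ⟨n, fun S x hS _ => ?_⟩
    rw [MvPolynomial.eval_C]
    exact hn.trans (pow_le_pow_left₀ (by norm_num) hS n)
  | add p q hp hq =>
    obtain ⟨n, hn⟩ := hp
    obtain ⟨m, hm⟩ := hq
    refine ⟨n + m + 1, fun S x hS hx => ?_⟩
    rw [map_add]
    exact (abs_add_le _ _).trans ((add_le_add (hn S x hS hx) (hm S x hS hx)).trans
      (pow_add_pow_le hS n m))
  | mul_X p i hp =>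
    obtain ⟨n, hn⟩ := hp
    refine ⟨n + 1, fun S x hS hx => ?_⟩
    rw [map_mul, MvPolynomial.eval_X, abs_mul, pow_succ]
    exact mul_le_mul (hn S x hS hx) (hx i) (abs_nonneg _) (by positivity)

/-- In both cases V grows linearly with a constant polynomial in S: for a network the growth bound
does not involve the depth. -/
lemma IsNextValue.growth {d N : ℕ} {i : Fin N} {g V : State d → ℝ} {S₀ S T Cf Cg : ℝ}
    {f : ℝ → State d → ℝ → State d → ℝ} (h : IsNextValue i g S₀ V) {n : ℕ}
    (hf : LipschitzCoefficients T Cf Cg f g) (hS : 2 ≤ S) (hS₀ : S₀ ≤ S ^ n)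
    (hC : 1 + coefConst Cf Cg f g ≤ S) :
    Measurable V ∧ ∀ x, |V x| ≤ S ^ (2 * n + 2) * (1 + ‖x‖) := by
  have h1 : 1 ≤ S := by linarith
  rcases h with ⟨_, rfl⟩ | ⟨_, hs, R, θ, hθ, hsize, rfl⟩
  · refine ⟨hf.measurable_terminal, fun x => (hf.terminal_le x).trans ?_⟩
    gcongr
    exact hC.trans (le_self_pow₀ h1 (by omega))
  · refine ⟨(continuous_netU θ).measurable, fun x => (abs_netU_le le_rfl hθ x).trans ?_⟩
    have hR0 : 0 ≤ R := (norm_nonneg _).trans hθ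
    have hR : R ≤ S ^ n := (le_max_left _ _).trans (hsize.trans hS₀)
    have hw : (netWidth d hs 1 : ℝ) ≤ S ^ n :=
      (le_max_right _ _).trans ((le_max_right _ _).trans (hsize.trans hS₀))
    gcongr
    calc R * ((netWidth d hs 1 : ℝ) + 1) ≤ S ^ n * (S ^ n + S ^ 0) := by
          rw [pow_zero]; gcongr
      _ ≤ S ^ n * S ^ (n + 0 + 1) := by gcongr; exact pow_add_pow_le hS n 0
      _ = S ^ (2 * n + 1) := by rw [← pow_add]; congr 1; omega
      _ ≤ S ^ (2 * n + 2) := pow_le_pow_right₀ h1 (by omega)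

/-- All constants of one time step are bounded by a fixed power of `2 + δ⁻¹ + d + C_{fg}`. -/
lemma exists_stepBound (T μ σ a b : ℝ) (hT : 0 < T) (hab : a < b) (n₀ : ℕ) :
    ∃ (β : ℝ) (n : ℕ), 1 ≤ n ∧ ∀ (M : ForwardModel) (d N : ℕ) (_ : 0 < d)
      (t : Fin (N + 1) → ℝ≥0) (_ : IsTimeGrid T t) (i : Fin N)
      (f : ℝ → State d → ℝ → State d → ℝ) (g : State d → ℝ) (Cf Cg : ℝ)
      (_ : LipschitzCoefficients T Cf Cg f g) (S S₀ : ℝ) (_ : 2 ≤ S) (_ : S₀ ≤ S ^ n₀)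
      (_ : 1 + coefConst Cf Cg f g ≤ S) (_ : (d : ℝ) ≤ S)
      (V : State d → ℝ) (_ : IsNextValue i g S₀ V),
      StepBound M μ σ a b β f (t i.castSucc) (t i.succ) V (S ^ n) := by
  obtain ⟨β, c, hβ, hc, hbound⟩ := exists_noise_bound T μ σ a b hT.le hab.le
  set C8 := ∫ x, Real.exp (8 * β * |x|) ∂gaussianReal 0 1 with hC8
  have hC80 : 0 ≤ C8 := integral_nonneg fun x => (Real.exp_pos _).le
  obtain ⟨k, hk⟩ := exists_le_two_pow (2 + T + c + 6561 * C8)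
  -- The exponent k absorbs the constants of T, μ, σ, a, b, with 6561 = 3⁸. The moment needs 8 more
  -- for d⁸, and the growth of V needs 2n₀ + 2.
  refine ⟨β, k + 2 * n₀ + 10, by omega,
    fun M d N hd t ht i f g Cf Cg hf S S₀ hS hS₀ hC hdS V hV => ?_⟩
  have h1 : 1 ≤ S := by linarith
  have hkS : 2 + T + c + 6561 * C8 ≤ S ^ k := hk.trans (pow_le_pow_left₀ (by norm_num) hS k)
  have hpow : ∀ j, j ≤ k + 2 * n₀ + 10 → S ^ j ≤ S ^ (k + 2 * n₀ + 10) := fun j hj =>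
    pow_le_pow_right₀ h1 hj
  have hlt : t i.castSucc < t i.succ := ht.strictMono (Fin.castSucc_lt_succ)
  have hsT : (t i.succ : ℝ) ≤ T := by
    rw [← ht.final]
    exact NNReal.coe_le_coe.2 (ht.strictMono.monotone (Fin.le_last _))
  have htT : (t i.castSucc : ℝ) ∈ Set.Icc 0 T :=
    ⟨(t i.castSucc).2, (NNReal.coe_le_coe.2 hlt.le).trans hsT⟩
  have hTk : T ≤ S ^ k := by linarith
  have hck : c ≤ S ^ (k + 2 * n₀ + 10) := le_trans (by linarith) (hpow k (by omega))
  have hfk : (1 + coefConst Cf Cg f g) * (2 + T) ≤ S ^ (k + 2 * n₀ + 10) := by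
    calc _ ≤ S * S ^ k := by gcongr; linarith
      _ = S ^ (k + 1) := by ring
      _ ≤ _ := hpow _ (by omega)
  have he : ∀ w : Fin 3 × Fin d → ℝ, 0 ≤ noiseEnvelope β w := fun w =>
    zero_le_one.trans (one_le_noiseEnvelope hd hβ w)
  have hB := hbound M d _ _ hlt.le hsT
  have hVg := hV.growth hf hS hS₀ hC
  exact
  { two_le := hS.trans (le_self_pow₀ h1 (by omega))
    dim_pos := hd
    dim_le := hdS.trans (le_self_pow₀ h1 (by omega))
    time_le := hlt.le
    step_le := by
      have : (0 : ℝ) ≤ t i.castSucc := (t i.castSucc).2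
      have := hpow k (by omega)
      linarith
    exponent_nonneg := hβ
    state_le := fun w => (hB w).1.trans (mul_le_mul_of_nonneg_right hck (he w))
    next_le := fun w => (hB w).2.1.trans (mul_le_mul_of_nonneg_right hck (he w))
    increment_le := fun w => (hB w).2.2.trans (mul_le_mul_of_nonneg_right hck (he w))
    moment_le := by
      refine (noiseEnvelope_moment β hβ).2.trans ?_
      calc C8 * (3 * d) ^ 8 = (6561 * C8) * (d : ℝ) ^ 8 := by ring
        _ ≤ S ^ k * S ^ 8 := by gcongr; linarith
        _ = S ^ (k + 8) := by ring
        _ ≤ _ := hpow _ (by omega)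
    measurable_driver := hf.measurable_driver htT
    measurable_next := hVg.1
    driver_le := fun x y z => (hf.driver_le htT x y z).trans (by gcongr)
    driver_sub_le := fun x y y' z z' => (hf.driver_sub_le htT x y y' z z').trans (by
      gcongr
      exact hC.trans (le_self_pow₀ h1 (by omega : k + 2 * n₀ + 10 ≠ 0)))
    next_value_le := fun x => (hVg.2 x).trans
      (mul_le_mul_of_nonneg_right (hpow _ (by omega)) (by positivity)) }

/-- Networks that approximate the optimal pair have almost optimal risk. -/
lemma IsOptimalPair.risk_le_of_approx {d : ℕ} {M : ForwardModel} {μ σ a b β : ℝ}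
    {f : ℝ → State d → ℝ → State d → ℝ} {t s : ℝ≥0} {V : State d → ℝ} {Y : ℝ}
    {Ω : Type*} [MeasurableSpace Ω] {P : Measure Ω} [IsProbabilityMeasure P]
    {η : Ω → Fin d → ℝ} {B : ℝ≥0 → Ω → Fin d → ℝ} (hB : IsDrivingNoise a b η B P) (hab : a < b)
    (h : StepBound M μ σ a b β f t s V Y) {U : State d → ℝ} {Z : State d → State d}
    (hopt : IsOptimalPair M μ σ η B P f t s V U Z) {hs : List ℕ} {θ : NetParams d hs}
    (hθ : ∫ ω, (U (forwardProcess M μ σ η B t ω) - netU θ.1 (forwardProcess M μ σ η B t ω)) ^ 2 ∂P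
      + ∫ ω, ‖Z (forwardProcess M μ σ η B t ω) - netZ θ.2 (forwardProcess M μ σ η B t ω)‖ ^ 2 ∂P
        ≤ (Y ^ 32)⁻¹) :
    ∫ w, residual M μ σ f t s V (netU θ.1) (netZ θ.2) (simulateNoise a b t s w) ^ 2 ∂stdNormal d ≤
      loss M μ σ η B P f t s V U Z + 1 / (2 * Y) := by
  obtain ⟨⟨hU, hZ, hUL, hZL⟩, hmin⟩ := hopt
  have hx := measurable_stateOf (d := d) M μ σ t
  have hnU := (continuous_netU θ.1).measurable
  have hnZ := (continuous_netZ θ.2).measurable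
  have hsim := measurable_simulateNoise (d := d) a b t s
  have hUL' := hB.memLp_comp hab h.time_le (hU.comp hx) hUL
  have hZL' := hB.memLp_comp hab h.time_le (hZ.comp hx) hZL
  -- The size of the networks serves only for integrability and does not enter the estimate.
  -- Otherwise `Y` would depend on the networks, hence on ε, which is itself chosen from `Y`.
  set C : ℝ := d * (‖θ‖ * ((netWidth d hs 1 : ℝ) + 1)) with hC
  have hC0 : 0 ≤ C := by positivity
  have hUg : ∀ x, |netU θ.1 x| ≤ C * (1 + ‖x‖) :=
    StepBound.netU_growth h.dim_pos le_rfl (norm_fst_le θ)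
  have hZg : ∀ x, ‖netZ θ.2 x‖ ≤ C * (1 + ‖x‖) := StepBound.netZ_growth le_rfl (norm_snd_le θ)
  have hNL := h.memLp_of_le ((hnU.comp hx).comp hsim).aestronglyMeasurable hC0 hUg
  have hNZL := h.memLp_of_le ((hnZ.comp hx).comp hsim).aestronglyMeasurable hC0 hZg
  have h' := h.mono (le_max_left Y C)
  have hi' : Integrable (fun w => residual M μ σ f t s V (netU θ.1) (netZ θ.2)
      (simulateNoise a b t s w) ^ 2) (stdNormal d) := by
    refine integrable_sq_of_abs_le (h.measurable_residual_simulate hnU hnZ).aestronglyMeasurable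
      (h'.abs_residual_le (fun x => (hUg x).trans (by gcongr; exact le_max_right _ _))
        (fun x => (hZg x).trans (by gcongr; exact le_max_right _ _))) ?_
    have e : ∀ w : Fin 3 × Fin d → ℝ, (12 * max Y C ^ 4 * noiseEnvelope β w ^ 2) ^ 4 =
        (12 * max Y C ^ 4) ^ 4 * noiseEnvelope β w ^ 8 := fun w => by ring
    simp_rw [e]
    exact (h.integrable_envelope_pow le_rfl).const_mul _
  have e1 := hB.integral_comp hab h.time_le
    (F := fun y => (U (stateOf M μ σ t y) - netU θ.1 (stateOf M μ σ t y)) ^ 2)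
    (((hU.comp hx).sub (hnU.comp hx)).pow_const 2)
  have e2 := hB.integral_comp hab h.time_le
    (F := fun y => ‖Z (stateOf M μ σ t y) - netZ θ.2 (stateOf M μ σ t y)‖ ^ 2)
    (((hZ.comp hx).sub (hnZ.comp hx)).norm.pow_const 2)
  have hε' := (add_le_add e1.ge e2.ge).trans hθ
  rw [hB.loss_eq hab h.time_le M μ σ h.measurable_driver h.measurable_next hU hZ]
  refine h.integral_sq_residual_le_add hU hnU hZ hnZ (hUL'.sub hNL).integrable_sq
    (hZL'.sub hNZL).norm.integrable_sq hε' le_rfl hi' ?_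
  have hadm : Admissible P (forwardProcess M μ σ η B t) (fun _ => 0) (fun _ => 0) :=
    ⟨measurable_const, measurable_const, memLp_const _, memLp_const _⟩
  have hm := hmin _ _ hadm
  rwa [hB.loss_eq hab h.time_le M μ σ h.measurable_driver h.measurable_next hU hZ,
    hB.loss_eq hab h.time_le M μ σ h.measurable_driver h.measurable_next measurable_const
      measurable_const] at hm

end DBDP

end

/-! ### Choice of the exponents and sum of the two errors. -/

theorem corollary4p4 (T μ σ a b : ℝ) (hT : 0 < T) (hab : a < b)
    (p : MvPolynomial (Fin 2) ℝ) (p₀ : MvPolynomial (Fin 3) ℝ) :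
    ∃ (q : MvPolynomial (Fin 4) ℝ) (r : MvPolynomial (Fin 3) ℝ),
      (∀ δ C : ℝ, ∀ d : ℕ, 0 < δ → 0 < d → 0 ≤ C →
        0 < MvPolynomial.eval ![δ⁻¹, (d : ℝ), C] r) ∧
      -- the problem: forward model, dimension, time grid, time step, coefficients
      ∀ (M : DBDP.ForwardModel) (d N : ℕ) (_ : 0 < d)
        (t : Fin (N + 1) → ℝ≥0) (_ : DBDP.IsTimeGrid T t) (i : Fin N)
        (f : ℝ → DBDP.State d → ℝ → DBDP.State d → ℝ) (g : DBDP.State d → ℝ) (Cf Cg : ℝ)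
        (_ : DBDP.LipschitzCoefficients T Cf Cg f g)
        -- the initial value and the Brownian motion
        (Ω₀ : Type*) (_ : MeasurableSpace Ω₀) (P₀ : Measure Ω₀) (_ : IsProbabilityMeasure P₀)
        (η : Ω₀ → Fin d → ℝ) (B : ℝ≥0 → Ω₀ → Fin d → ℝ) (_ : DBDP.IsDrivingNoise a b η B P₀)
        -- accuracy and failure probability
        (δ ρ : ℝ) (_ : 0 < δ) (_ : 0 < ρ)
        -- the next value function and the optimal pair of functions
        (V : DBDP.State d → ℝ)
        (_ : DBDP.IsNextValue i g
          (MvPolynomial.eval ![δ⁻¹, (d : ℝ), DBDP.coefConst Cf Cg f g] p₀) V)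
        (Uopt : DBDP.State d → ℝ) (Zopt : DBDP.State d → DBDP.State d)
        (_ : DBDP.IsOptimalPair M μ σ η B P₀ f (t i.castSucc) (t i.succ) V Uopt Zopt)
        -- for each accuracy `ε`, networks of polynomial size that approximate the optimal pair
        (hs : ℝ → List ℕ) (R : ℝ → ℝ)
        (_ : ∀ ε : ℝ, 0 < ε → DBDP.ApproximatesAt P₀
          (DBDP.forwardProcess M μ σ η B (t i.castSucc)) Uopt Zopt p ε (hs ε) (R ε))
        -- the accuracy at which the networks are taken
        (ε : ℝ) (_ : ε = (MvPolynomial.eval ![δ⁻¹, (d : ℝ), DBDP.coefConst Cf Cg f g] r)⁻¹)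
        -- the samples and the empirical minimizer
        (Ω : Type*) (_ : MeasurableSpace Ω) (P : Measure Ω) (_ : IsProbabilityMeasure P)
        (m : ℕ) (w : Fin m → Ω → Fin 3 × Fin d → ℝ) (_ : iIndepFun w P)
        (_ : ∀ j, HasLaw (w j) (DBDP.stdNormal d) P)
        (θ : Ω → DBDP.NetParams d (hs ε)) (_ : AEMeasurable θ P)
        (_ : ∀ᵐ ω ∂P, DBDP.IsEmpiricalMinimizer M μ σ a b f (t i.castSucc) (t i.succ) V
          (fun j => w j ω) (R ε) (θ ω)),
        MvPolynomial.eval ![δ⁻¹, ρ⁻¹, (d : ℝ), DBDP.coefConst Cf Cg f g] q ≤ (m : ℝ) →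
          1 - ρ ≤ P.real {ω |
            DBDP.loss M μ σ η B P₀ f (t i.castSucc) (t i.succ) V
                (DBDP.netU (θ ω).1) (DBDP.netZ (θ ω).2)
              - DBDP.loss M μ σ η B P₀ f (t i.castSucc) (t i.succ) V Uopt Zopt ≤ δ} := by
  obtain ⟨n₀, hn₀⟩ := DBDP.exists_abs_eval_le_pow p₀
  obtain ⟨n₁, hn₁⟩ := DBDP.exists_abs_eval_le_pow p
  obtain ⟨β, n, hn, hstep⟩ := DBDP.exists_stepBound T μ σ a b hT hab n₀
  -- There is no circularity: n comes from the step constants alone and fixes ε = S^(-32n). Then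
  -- p(d, ε⁻¹) ≤ S^k bounds the networks, and K also accommodates their growth constant d R (w + 1)
  -- ≤ S^(2k+2).
  set k := (32 * n + 1) * n₁ with hk
  set K := n + (2 * k + 2) with hK
  refine ⟨(MvPolynomial.C 2 + MvPolynomial.X 0 + MvPolynomial.X 1 + MvPolynomial.X 2 +
      MvPolynomial.X 3) ^ (132 * K + 1),
    (MvPolynomial.C 2 + MvPolynomial.X 0 + MvPolynomial.X 1 + MvPolynomial.X 2) ^ (32 * n),
    fun δ C d hδ hd hC => ?_, ?_⟩
  · simp only [map_pow, map_add, MvPolynomial.eval_C, MvPolynomial.eval_X, Matrix.cons_val]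
    positivity
  intro M d N hd t ht i f g Cf Cg hf Ω₀ _ P₀ _ η B hB δ ρ hδ hρ V hV Uopt Zopt hopt hs R happ ε hε
    Ω _ P _ m w hind hlaw θ _ hmin hm
  set C := DBDP.coefConst Cf Cg f g with hC
  have hC0 : 0 ≤ C := DBDP.coefConst_nonneg Cf Cg f g
  set S : ℝ := 2 + δ⁻¹ + d + C with hS
  have hδ' : 0 < δ⁻¹ := inv_pos.2 hδ
  have hρ' : 0 < ρ⁻¹ := inv_pos.2 hρ
  have hd0 : (0 : ℝ) ≤ d := Nat.cast_nonneg d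
  have hS2 : 2 ≤ S := by linarith
  have hS1 : 1 ≤ S := by linarith
  have hdS : (d : ℝ) ≤ S := by linarith
  have hV' : MvPolynomial.eval ![δ⁻¹, (d : ℝ), C] p₀ ≤ S ^ n₀ := by
    refine (le_abs_self _).trans (hn₀ S _ hS2 fun j => ?_)
    fin_cases j
    · simpa [abs_of_pos hδ] using show δ⁻¹ ≤ S by linarith
    · simpa using hdS
    · simpa [abs_of_nonneg hC0] using show C ≤ S by linarith
  have hY := hstep M d N hd t ht i f g Cf Cg hf S _ hS2 hV' (by linarith) hdS V hV
  have hε' : ε = ((S ^ n) ^ 32)⁻¹ := by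
    rw [hε]
    simp only [map_pow, map_add, MvPolynomial.eval_C, MvPolynomial.eval_X, Matrix.cons_val]
    rw [← pow_mul, mul_comm n]
  have hε0 : 0 < ε := by rw [hε']; positivity
  obtain ⟨hsize, θ₀, hθ₀, hθ₀ε⟩ := happ ε hε0
  have hp : MvPolynomial.eval ![(d : ℝ), ε⁻¹] p ≤ S ^ k := by
    refine (le_abs_self _).trans ((hn₁ (S ^ (32 * n + 1)) _
      (hS2.trans (le_self_pow₀ hS1 (by omega))) fun j => ?_).trans_eq ?_)
    · fin_cases j
      · simpa using hdS.trans (le_self_pow₀ hS1 (by omega))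
      · have : ε⁻¹ ≤ S ^ (32 * n + 1) := by
          rw [hε', inv_inv, ← pow_mul, mul_comm n]
          exact pow_le_pow_right₀ hS1 (by omega)
        simpa [abs_of_pos hε0] using this
    · rw [← pow_mul]
  have hsize' := hsize.trans hp
  have hR : R ε ≤ S ^ k := (le_max_left _ _).trans hsize'
  have hD : (DBDP.netDepth (hs ε) : ℝ) ≤ S ^ k :=
    (le_max_left _ _).trans ((le_max_right _ _).trans hsize')
  have hw : (DBDP.netWidth d (hs ε) 1 : ℝ) ≤ S ^ k :=
    (le_max_right _ _).trans ((le_max_right _ _).trans hsize')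
  have hR0 : 0 ≤ R ε := (norm_nonneg _).trans hθ₀
  have hkK : S ^ k ≤ S ^ K := pow_le_pow_right₀ hS1 (by omega)
  have hnK : S ^ n ≤ S ^ K := pow_le_pow_right₀ hS1 (by omega)
  have hgrow : d * (R ε * ((DBDP.netWidth d (hs ε) 1 : ℝ) + 1)) ≤ S ^ K := by
    calc d * (R ε * ((DBDP.netWidth d (hs ε) 1 : ℝ) + 1)) ≤ S * (S ^ k * (S ^ k + S ^ 0)) := by
          rw [pow_zero]; gcongr
      _ ≤ S * (S ^ k * S ^ (k + 0 + 1)) := by gcongr; exact DBDP.pow_add_pow_le hS2 k 0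
      _ = S ^ (2 * k + 2) := by ring
      _ ≤ S ^ K := pow_le_pow_right₀ hS1 (by omega)
  -- The polynomial q has the value (S + ρ⁻¹)^(132K+1). The extra power supplies the factor 1 + ρ⁻¹.
  have hm' : (S ^ K) ^ 132 * (1 + ρ⁻¹) ≤ m := by
    refine le_trans ?_ hm
    simp only [map_pow, map_add, MvPolynomial.eval_C, MvPolynomial.eval_X, Matrix.cons_val]
    have e : 2 + δ⁻¹ + ρ⁻¹ + (d : ℝ) + C = S + ρ⁻¹ := by rw [hS]; ring
    rw [e, ← pow_mul, mul_comm K, pow_succ]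
    gcongr
    all_goals linarith
  have hrisk := hopt.risk_le_of_approx hB hab hY (hθ₀ε.trans_eq hε')
  -- The approximation error was estimated at the level S^n; the statistical error uses the level
  -- S^K, which also bounds the networks.
  refine ((hY.mono hnK).empirical_minimizer_le (hR.trans hkK) (hw.trans hkK) (hD.trans hkK) hgrow
    hind hlaw hmin hθ₀ hρ hm').trans (measureReal_mono fun ω hω => ?_)
  rw [Set.mem_ofPred_eq] at hω ⊢
  rw [hB.loss_eq hab hY.time_le M μ σ hY.measurable_driver hY.measurable_next
    (DBDP.continuous_netU (θ ω).1).measurable (DBDP.continuous_netZ (θ ω).2).measurable]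
  have hδY : 1 / (2 * S ^ n) ≤ δ / 2 := by
    have h1 : δ⁻¹ ≤ S ^ n := le_trans (by linarith) (le_self_pow₀ hS1 (by omega : n ≠ 0))
    have h2 : (S ^ n)⁻¹ ≤ δ := inv_le_of_inv_le₀ hδ h1
    calc 1 / (2 * S ^ n) = (S ^ n)⁻¹ / 2 := by rw [one_div, mul_inv]; ring
      _ ≤ δ / 2 := by linarith
  have hδK : 1 / (2 * S ^ K) ≤ δ / 2 := le_trans (by gcongr) hδY
  linarith
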